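/- Let $n\ge 1$ and let $A$ be an alternating $n$-quasigroup: a set $A$ with an operation $f\colon A^n\to A$ such that $f(x_1,\dots,x_n)=y$ is uniquely solvable for each $x_i$ when $y$ and the other $x_j$ are given, and such that $f$ is invariant under even permutations of its arguments. Let $\mathrm{NCT}(A)$ be the set of tuples $a\in A^n$ with $f(a_{\sigma(1)},\dots,a_{\sigma(n)})\ne f(a)$ for some permutation $\sigma$. Take two disjoint copies $\{\underline{x}\},\{\overline{x}\}$ of $A$ as vertices, and let $\Gamma$ be the simplicial complex whose faces are the subsets of the sets $\{\underline a_1,\dots,\underline a_n,\overline{f(a)}\}$ with $a\in\mathrm{NCT}(A)$. Write $\mathrm{ocvx}(\gamma)$ for the relative interior of the convex hull of the basis vectors labelled by $\gamma$ in the real vector space $\mathbb R^{V}$ of the vertices, with the product topology. The open serenation $\mathrm{OSer}(A)$ is the subspace $\bigcup\mathrm{ocvx}(\gamma)$ of $\mathbb R^V$, over all faces $\gamma$ of $\Gamma$ with $n$ or $n+1$ elements. For $a\in\mathrm{NCT}(A)$ let $a'$ be $a$ with its last two entries swapped, and let $a_{n+1}$ be the unique element with $f(a_1,\dots,a_{n-2},a_{n+1},a_{n-1})=f(a)$.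 Let $B_n\subset\mathbb R^n$ be the interior of the convex hull of $0,\ (\tfrac2n,\dots,\tfrac2n),\ e_1,\dots,e_n$. For vertices $p_1,\dots,p_n,q,q'$ put, with $s=\sum_i u_i$, $$\phi_{p,q,q'}(u)=\begin{cases}\sum_i u_i\,p_i+(1-s)\,q & s\le 1,\\ \frac2n\sum_i\bigl(1+\tfrac{n-2}{2}u_i-\sum_{j\ne i}u_j\bigr)p_i+(s-1)\,q' & s>1.\end{cases}$$ The serene charts are the maps $B_n\to\mathrm{OSer}(A)$ given, for $a\in\mathrm{NCT}(A)$, by $\underline\phi_a$ ($p_i=\underline a_i$, $q=\overline{f(a)}$, $q'=\overline{f(a')}$) and $\overline\phi_a$ ($p_i=\underline a_i$ for $i<n$, $p_n=\overline{f(a)}$, $q=\underline a_n$, $q'=\underline a_{n+1}$). The standard metric $g$ on $\mathrm{OSer}(A)$ is the field of bilinear forms on tangent spaces with 1. $g_x(\underline a_i-\overline{f(a)},\underline a_j-\overline{f(a)})=1+\delta_{ij}$ for $x\in\mathrm{ocvx}(\{\underline a_1,\dots,\underline a_n,\overline{f(a)}\})$, where tangent vectors are viewed as vectors of $\mathbb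 R^V$; 2. $g_x(\partial_i,\partial_j)=1+\delta_{ij}$ for $x\in\mathrm{ocvx}(\{\underline a_1,\dots,\underline a_{n-1},\overline{f(a)}\})$, where $\partial_1,\dots,\partial_n$ are the coordinate vectors of $\overline\phi_a$ (identified with $\underline a_1,\dots,\underline a_{n-1},\overline{f(a)}$); 3. $g_x(\partial_i,\partial_j)=1+\delta_{ij}$ for $x\in\mathrm{ocvx}(\{\underline a_1,\dots,\underline a_n\})$, where $\partial_1,\dots,\partial_n$ are the coordinate vectors of $\underline\phi_a$ (identified with $\underline a_1,\dots,\underline a_n$). **Proposition.** For every alternating $n$-quasigroup $A$, $\mathrm{OSer}(A)$ with the atlas of serene charts is a smooth $n$-manifold (Hausdorff, with second countable connected components), there is exactly one field of bilinear forms $g$ satisfying 1–3, it is a smooth Riemannian metric, its matrix in every serene chart is the constant matrix $J_n+I_n$ ($J_n$ the all-ones matrix, $I_n$ the identity matrix), and $(\mathrm{OSer}(A),g)$ is flat, that is, its Riemann curvature tensor vanishes. -/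

import Mathlib

open scoped Manifold ContDiff

namespace Serenation


/-- The relative interior (in the affine hull) of the convex hull of `X`. -/
def ocvx {E : Type*} [AddCommGroup E] [Module ℝ E] [TopologicalSpace E] (X : Set E) : Set E :=
  intrinsicInterior ℝ (convexHull ℝ X)

theorem exists_extend_of_mem_ocvx {E : Type*} [AddCommGroup E] [Module ℝ E] [TopologicalSpace E]
    [ContinuousAdd E] [ContinuousSMul ℝ E] {X : Set E} {x y : E} (hx : x ∈ ocvx X) (hy : y ∈ X) :
    x ∈ convexHull ℝ X ∧ ∃ t : ℝ, 0 < t ∧ x + t • (x - y) ∈ convexHull ℝ X := by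
  obtain ⟨x', hx', rfl⟩ := hx
  have hsub : ∀ z ∈ interior (((↑) : affineSpan ℝ (convexHull ℝ X) → E) ⁻¹' convexHull ℝ X),
      (z : E) ∈ convexHull ℝ X := fun z hz => Set.mem_preimage.1 (interior_subset hz)
  refine ⟨hsub _ hx', ?_⟩
  have hyS : y ∈ affineSpan ℝ (convexHull ℝ X) :=
    subset_affineSpan ℝ _ (subset_convexHull ℝ _ hy)
  have hmem : ∀ t : ℝ, (x' : E) + t • ((x' : E) - y) ∈ affineSpan ℝ (convexHull ℝ X) := by
    intro t
    have := AffineMap.lineMap_mem (Q := affineSpan ℝ (convexHull ℝ X)) (-t) x'.2 hyS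
    convert this using 1
    simp only [AffineMap.lineMap_apply, vsub_eq_sub, vadd_eq_add]
    module
  let c : ℝ → affineSpan ℝ (convexHull ℝ X) := fun t => ⟨_, hmem t⟩
  have hc : Continuous c := by
    refine Continuous.subtype_mk ?_ _
    fun_prop
  have h0 : c 0 = x' := by
    apply Subtype.ext
    simp [c]
  have hopen : IsOpen (c ⁻¹' interior ((↑) ⁻¹' convexHull ℝ X)) := isOpen_interior.preimage hc
  have hz : (0 : ℝ) ∈ c ⁻¹' interior ((↑) ⁻¹' convexHull ℝ X) := by
    rw [Set.mem_preimage, h0]; exact hx'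
  obtain ⟨ε, hε, hb⟩ := Metric.isOpen_iff.1 hopen 0 hz
  refine ⟨ε / 2, by positivity, ?_⟩
  have : ε / 2 ∈ Metric.ball (0 : ℝ) ε := by
    simp [abs_of_pos hε, hε]
  exact hsub _ (Set.mem_preimage.1 (hb this))

theorem mem_ocvx_of_isOpen {E : Type*} [AddCommGroup E] [Module ℝ E] [TopologicalSpace E]
    {X U : Set E} {x : E} (hU : IsOpen U) (hxU : x ∈ U)
    (hx : x ∈ affineSpan ℝ (convexHull ℝ X))
    (h : ∀ y ∈ U, y ∈ affineSpan ℝ (convexHull ℝ X) → y ∈ convexHull ℝ X) : x ∈ ocvx X := by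
  refine ⟨⟨x, hx⟩, ?_, rfl⟩
  refine mem_interior.2 ⟨(↑) ⁻¹' U, ?_, hU.preimage continuous_subtype_val,
    Set.mem_preimage.2 hxU⟩
  intro y hy
  exact Set.mem_preimage.2 (h y.1 (Set.mem_preimage.1 hy) y.2)

section Simplex

variable {V : Type*}

open Classical in
/-- The basis element of `ℝ^V` identified with the vertex `s`. -/
noncomputable def vertexPt (s : V) : V → ℝ := Pi.single s 1

theorem vertexPt_self (s : V) : vertexPt s s = 1 := by simp [vertexPt]

theorem vertexPt_ne {s t : V} (h : t ≠ s) : vertexPt s t = 0 := by simp [vertexPt, h]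

theorem mem_ocvx_vertexPt_iff (t : Finset V) (ht : t.Nonempty) (x : V → ℝ) :
    x ∈ ocvx (vertexPt '' (t : Set V)) ↔
      (∀ s ∈ t, 0 < x s) ∧ (∀ s ∉ t, x s = 0) ∧ ∑ s ∈ t, x s = 1 := by
  classical
  have hspan : ∀ y ∈ affineSpan ℝ (convexHull ℝ (vertexPt '' (t : Set V))),
      (∀ s ∉ t, y s = 0) ∧ ∑ s ∈ t, y s = 1 := by
    intro y hy
    let Q : AffineSubspace ℝ (V → ℝ) :=
      { carrier := {y | (∀ s ∉ t, y s = 0) ∧ ∑ s ∈ t, y s = 1}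
        smul_vsub_vadd_mem' := by
          rintro c a b d ⟨ha, ha'⟩ ⟨hb, hb'⟩ ⟨hd, hd'⟩
          refine ⟨fun s hs => by simp [ha s hs, hb s hs, hd s hs], ?_⟩
          simp [Finset.sum_add_distrib, ← Finset.mul_sum, ha', hb', hd'] }
    have : affineSpan ℝ (convexHull ℝ (vertexPt '' (t : Set V))) ≤ Q := by
      rw [affineSpan_convexHull]
      rw [affineSpan_le]
      rintro _ ⟨s, hs, rfl⟩
      refine ⟨fun r hr => vertexPt_ne (by rintro rfl; exact hr hs), ?_⟩
      rw [Finset.sum_eq_single s]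
      · exact vertexPt_self s
      · intro r _ hr; exact vertexPt_ne hr
      · intro h; exact absurd hs h
    exact this hy
  have hhull : ∀ y : V → ℝ, (∀ s ∈ t, 0 ≤ y s) → (∀ s ∉ t, y s = 0) → ∑ s ∈ t, y s = 1 →
      y ∈ convexHull ℝ (vertexPt '' (t : Set V)) := by
    intro y h1 h2 h3
    have : y = ∑ s ∈ t, y s • vertexPt s := by
      funext r
      simp only [Finset.sum_apply, Pi.smul_apply, smul_eq_mul]
      by_cases hr : r ∈ t
      · rw [Finset.sum_eq_single r]
        · simp [vertexPt_self]
        · intro s _ hs; simp [vertexPt_ne hs.symm]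
        · intro h; exact absurd hr h
      · rw [h2 r hr, Finset.sum_eq_zero]
        intro s hs
        rw [vertexPt_ne (by rintro rfl; exact hr hs), mul_zero]
    rw [this]
    exact (convex_convexHull ℝ _).sum_mem h1 h3
      (fun s hs => subset_convexHull ℝ _ ⟨s, hs, rfl⟩)
  have hnonneg : ∀ y ∈ convexHull ℝ (vertexPt '' (t : Set V)), ∀ s, 0 ≤ y s := by
    intro y hy s
    have hcv : Convex ℝ {y : V → ℝ | 0 ≤ y s} :=
      (convex_Ici (0 : ℝ)).linear_preimage (LinearMap.proj (R := ℝ) (φ := fun _ : V => ℝ) s)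
    refine convexHull_min ?_ hcv hy
    rintro _ ⟨r, _, rfl⟩
    by_cases h : s = r
    · subst h; simp [vertexPt_self]
    · simp [vertexPt_ne h]
  constructor
  · intro hx
    obtain ⟨s0, hs0⟩ := ht
    have hxh := (exists_extend_of_mem_ocvx hx ⟨s0, hs0, rfl⟩).1
    obtain ⟨h2, h3⟩ := hspan x (subset_affineSpan ℝ _ hxh)
    refine ⟨fun s hs => ?_, h2, h3⟩
    obtain ⟨_, τ, hτ, hmem⟩ := exists_extend_of_mem_ocvx hx ⟨s, hs, rfl⟩
    have := hnonneg _ hmem s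
    simp only [Pi.add_apply, Pi.smul_apply, Pi.sub_apply, vertexPt_self, smul_eq_mul] at this
    by_contra hneg
    have : x s ≤ 0 := not_lt.1 hneg
    nlinarith
  · rintro ⟨h1, h2, h3⟩
    refine mem_ocvx_of_isOpen (U := ⋂ s ∈ t, {y : V → ℝ | 0 < y s}) ?_ ?_ ?_ ?_
    · exact isOpen_biInter_finset fun s _ => isOpen_lt continuous_const (continuous_apply s)
    · simpa using h1
    · exact subset_affineSpan ℝ _ (hhull x (fun s hs => (h1 s hs).le) h2 h3)
    · intro y hy hys
      obtain ⟨h2', h3'⟩ := hspan y hys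
      refine hhull y (fun s hs => ?_) h2' h3'
      have : ∀ s ∈ t, 0 < y s := by simpa using hy
      exact (this s hs).le

end Simplex

section Bipyramid

/-- The standard open bipyramid in `ℝ^n`: the open convex hull of the origin, the point
`(2/n, …, 2/n)` and the standard basis. -/
noncomputable def bipyr (n : ℕ) : Set (EuclideanSpace ℝ (Fin n)) :=
  ocvx ({0, WithLp.toLp 2 (fun _ => 2 / (n : ℝ))} ∪
    Set.range (fun i : Fin n => EuclideanSpace.single i (1 : ℝ)))

/-- The `i`-th coordinate `(2/n) (1 + ((n-2)/2) u_i - ∑_{j ≠ i} u_j)` of the mirror image of `u`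
in the hyperplane `∑ u_j = 1`. -/
noncomputable def mirror {n : ℕ} (u : EuclideanSpace ℝ (Fin n)) (i : Fin n) : ℝ :=
  2 / (n : ℝ) * (1 + ((n : ℝ) - 2) / 2 * u i - ∑ j ∈ Finset.univ.erase i, u j)

theorem mirror_eq {n : ℕ} (u : EuclideanSpace ℝ (Fin n)) (i : Fin n) :
    mirror u i = u i + 2 / (n : ℝ) * (1 - ∑ j, u j) := by
  have hn : (n : ℝ) ≠ 0 := by
    have := i.pos
    positivity
  rw [mirror, ← Finset.add_sum_erase Finset.univ (fun j => u j) (Finset.mem_univ i)]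
  field_simp
  ring

theorem sum_mirror {n : ℕ} (hn : 1 ≤ n) (u : EuclideanSpace ℝ (Fin n)) :
    ∑ i, mirror u i = 2 - ∑ j, u j := by
  have hn : (n : ℝ) ≠ 0 := by positivity
  simp only [mirror_eq, Finset.sum_add_distrib, Finset.sum_const, Finset.card_univ,
    Fintype.card_fin, nsmul_eq_mul]
  field_simp
  ring

theorem continuous_mirror {n : ℕ} (i : Fin n) :
    Continuous (fun u : EuclideanSpace ℝ (Fin n) => mirror u i) := by
  simp only [mirror_eq]
  fun_prop

theorem continuous_coord {n : ℕ} (i : Fin n) :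
    Continuous (fun u : EuclideanSpace ℝ (Fin n) => u i) := by fun_prop

theorem mem_bipyr {n : ℕ} (hn : 1 ≤ n) (u : EuclideanSpace ℝ (Fin n)) :
    u ∈ bipyr n ↔ ∀ i, 0 < u i ∧ 0 < mirror u i := by
  have hn0 : (0 : ℝ) < n := by exact_mod_cast hn
  set X : Set (EuclideanSpace ℝ (Fin n)) := {0, WithLp.toLp 2 (fun _ => 2 / (n : ℝ))} ∪
    Set.range (fun i : Fin n => EuclideanSpace.single i (1 : ℝ)) with hX
  have hle : ∀ y ∈ convexHull ℝ X, ∀ i, 0 ≤ y i ∧ 0 ≤ mirror y i := by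
    intro y hy i
    have hcv : Convex ℝ {y : EuclideanSpace ℝ (Fin n) | 0 ≤ y i ∧ 0 ≤ mirror y i} := by
      rintro a ⟨ha, ha'⟩ b ⟨hb, hb'⟩ s t hs ht hst
      refine ⟨by simp; positivity, ?_⟩
      have : mirror (s • a + t • b) i = s * mirror a i + t * mirror b i := by
        simp only [mirror_eq, PiLp.add_apply, PiLp.smul_apply, smul_eq_mul,
          Finset.sum_add_distrib, ← Finset.mul_sum]
        have : t = 1 - s := by linarith
        subst this
        ring
      rw [this]; positivity
    refine convexHull_min ?_ hcv hy
    rintro y ((rfl | rfl) | ⟨j, rfl⟩)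
    · refine ⟨by simp, ?_⟩
      simp only [mirror_eq, PiLp.zero_apply, Finset.sum_const_zero]
      positivity
    · refine ⟨by simp; positivity, ?_⟩
      rw [mirror_eq]
      simp only [Finset.sum_const, Finset.card_univ, Fintype.card_fin, nsmul_eq_mul]
      apply le_of_eq
      field_simp
      ring
    · rw [Set.mem_ofPred_eq, mirror_eq]
      simp [PiLp.single_apply]
      split_ifs <;> norm_num
  have hdec : ∀ w : EuclideanSpace ℝ (Fin n),
      ∑ i, w i • EuclideanSpace.single i (1 : ℝ) = w := by
    intro w
    ext k
    simp [Pi.single_apply]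
  have hge : ∀ y : EuclideanSpace ℝ (Fin n), (∀ i, 0 < y i ∧ 0 < mirror y i) →
      y ∈ convexHull ℝ X := by
    intro y hy
    by_cases hs : ∑ i, y i ≤ 1
    · have key := (convex_convexHull ℝ X).sum_mem (t := Finset.univ)
        (w := fun o : Option (Fin n) => o.elim (1 - ∑ i, y i) (fun i => y i))
        (z := fun o : Option (Fin n) => o.elim 0 (fun i => EuclideanSpace.single i (1 : ℝ)))
        (by rintro (_ | i) _
            · simpa using hs
            · exact (hy i).1.le)
        (by simp [Fintype.sum_option])
        (by rintro (_ | i) _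
            · exact subset_convexHull ℝ _ (by simp [hX])
            · exact subset_convexHull ℝ _ (by simp [hX]))
      simpa [Fintype.sum_option, hdec] using key
    · have key := (convex_convexHull ℝ X).sum_mem (t := Finset.univ)
        (w := fun o : Option (Fin n) => o.elim (∑ i, y i - 1) (fun i => mirror y i))
        (z := fun o : Option (Fin n) => o.elim (WithLp.toLp 2 (fun _ => 2 / (n : ℝ)))
          (fun i => EuclideanSpace.single i (1 : ℝ)))
        (by rintro (_ | i) _
            · simp; linarith
            · exact (hy i).2.le)
        (by simp [Fintype.sum_option, sum_mirror hn]; ring)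
        (by rintro (_ | i) _
            · exact subset_convexHull ℝ _ (by simp [hX])
            · exact subset_convexHull ℝ _ (by simp [hX]))
      convert key using 1
      ext k
      simp [Fintype.sum_option, Pi.single_apply, mirror_eq]
      ring
  constructor
  · intro hu i
    obtain ⟨hmem, τ, hτ, h⟩ := exists_extend_of_mem_ocvx (X := X)
      (y := EuclideanSpace.single i (1 : ℝ)) hu (by simp [hX])
    have h1 := hle _ hmem i
    have h2 := hle _ h i
    rw [mirror_eq] at h1 h2
    rw [mirror_eq]
    simp [PiLp.single_apply, Finset.sum_add_distrib, ← Finset.mul_sum] at h2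
    constructor
    · by_contra hneg
      have : u i ≤ 0 := not_lt.1 hneg
      nlinarith
    · by_contra hneg
      have := not_lt.1 hneg
      nlinarith
  · intro hu
    refine mem_ocvx_of_isOpen (X := X)
      (U := ⋂ i, {y : EuclideanSpace ℝ (Fin n) | 0 < y i ∧ 0 < mirror y i}) ?_ ?_ ?_ ?_
    · refine isOpen_iInter_of_finite fun i => ?_
      exact (isOpen_lt continuous_const (continuous_coord i)).inter
        (isOpen_lt continuous_const (continuous_mirror i))
    · simpa using hu
    · exact subset_affineSpan ℝ _ (hge u hu)
    · intro y hy _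
      exact hge y (by simpa using hy)

theorem isOpen_bipyr {n : ℕ} (hn : 1 ≤ n) : IsOpen (bipyr n) := by
  have : bipyr n = ⋂ i, {y : EuclideanSpace ℝ (Fin n) | 0 < y i ∧ 0 < mirror y i} := by
    ext u
    simp [mem_bipyr hn]
  rw [this]
  refine isOpen_iInter_of_finite fun i => ?_
  exact (isOpen_lt continuous_const (continuous_coord i)).inter
    (isOpen_lt continuous_const (continuous_mirror i))

theorem center_mem_bipyr {n : ℕ} (hn : 1 ≤ n) :
    (WithLp.toLp 2 (fun _ => 1 / (n : ℝ)) : EuclideanSpace ℝ (Fin n)) ∈ bipyr n := by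
  have hn0 : (0 : ℝ) < n := by exact_mod_cast hn
  rw [mem_bipyr hn]
  intro i
  rw [mirror_eq]
  simp [hn0, hn0.ne']

end Bipyramid


section Realization

variable {V : Type*}

/-- The open geometric realization of a complex `Γ` with vertices in `V`: the union of the open
simplices spanned by the faces with `n` or `n + 1` vertices. Coordinates at elements of `V` that
are not vertices of `Γ` vanish identically. -/
def openRealization (n : ℕ) (Γ : Set (Set V)) : Set (V → ℝ) :=
  ⋃ γ ∈ {γ : Set V | γ ∈ Γ ∧ (γ.ncard = n ∨ γ.ncard = n + 1)}, ocvx (vertexPt '' γ)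

/-- The map on the bipyramid with crease vertices `p` and apexes `q`, `q'`. -/
noncomputable def bipyrMap {n : ℕ} (p : Fin n → V) (q q' : V) (u : EuclideanSpace ℝ (Fin n)) :
    V → ℝ :=
  if ∑ i, u i ≤ 1 then ∑ i, u i • vertexPt (p i) + (1 - ∑ i, u i) • vertexPt q
  else ∑ i, mirror u i • vertexPt (p i) + (-1 + ∑ i, u i) • vertexPt q'

theorem bipyrMap_apply {n : ℕ} (p : Fin n → V) (q q' : V) (u : EuclideanSpace ℝ (Fin n)) (s : V) :
    bipyrMap p q q' u s = ∑ i, min (u i) (mirror u i) * vertexPt (p i) s +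
      max (1 - ∑ i, u i) 0 * vertexPt q s + max (∑ i, u i - 1) 0 * vertexPt q' s := by
  have hn : (0 : ℝ) ≤ 2 / (n : ℝ) := by positivity
  unfold bipyrMap
  split_ifs with h
  · have : ∀ i, min (u i) (mirror u i) = u i := by
      intro i
      rw [min_eq_left]
      rw [mirror_eq]
      nlinarith
    simp only [this]
    rw [max_eq_left (by linarith), max_eq_right (by linarith)]
    simp [Finset.sum_apply]
  · have : ∀ i, min (u i) (mirror u i) = mirror u i := by
      intro i
      rw [min_eq_right]
      rw [mirror_eq]
      nlinarith
    simp only [this]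
    rw [max_eq_right (by linarith), max_eq_left (by linarith)]
    simp only [Pi.add_apply, Finset.sum_apply, Pi.smul_apply, smul_eq_mul]
    ring

theorem continuous_bipyrMap {n : ℕ} (p : Fin n → V) (q q' : V) :
    Continuous (bipyrMap p q q') := by
  refine continuous_pi fun s => ?_
  simp only [bipyrMap_apply]
  have h1 : ∀ i : Fin n, Continuous fun u : EuclideanSpace ℝ (Fin n) => min (u i) (mirror u i) :=
    fun i => (continuous_coord i).min (continuous_mirror i)
  fun_prop

/-- A configuration of two facets of `Γ` sharing the face spanned by `p`, such that every face
containing the shared face lies in one of the two facets. -/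
structure Star (n : ℕ) (Γ : Set (Set V)) where
  p : Fin n → V
  q : V
  q' : V
  pos : 1 ≤ n
  inj : Function.Injective p
  hq : ∀ i, p i ≠ q
  hq' : ∀ i, p i ≠ q'
  hne : q ≠ q'
  crease : Set.range p ∈ Γ
  face : insert q (Set.range p) ∈ Γ
  face' : insert q' (Set.range p) ∈ Γ
  sub : ∀ γ ∈ Γ, Set.range p ⊆ γ → γ ⊆ insert q (Set.range p) ∨ γ ⊆ insert q' (Set.range p)

namespace Star

variable {n : ℕ} {Γ : Set (Set V)} (S : Star n Γ)

theorem map_p (u : EuclideanSpace ℝ (Fin n)) (i : Fin n) :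
    bipyrMap S.p S.q S.q' u (S.p i) = min (u i) (mirror u i) := by
  rw [bipyrMap_apply, vertexPt_ne (S.hq i), vertexPt_ne (S.hq' i), Finset.sum_eq_single i]
  · simp [vertexPt_self]
  · intro j _ hj
    rw [vertexPt_ne (fun h => hj (S.inj h).symm), mul_zero]
  · simp

theorem map_q (u : EuclideanSpace ℝ (Fin n)) :
    bipyrMap S.p S.q S.q' u S.q = max (1 - ∑ i, u i) 0 := by
  rw [bipyrMap_apply, vertexPt_self, vertexPt_ne S.hne, Finset.sum_eq_zero]
  · simp
  · intro i _
    rw [vertexPt_ne (S.hq i).symm, mul_zero]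

theorem map_q' (u : EuclideanSpace ℝ (Fin n)) :
    bipyrMap S.p S.q S.q' u S.q' = max (∑ i, u i - 1) 0 := by
  rw [bipyrMap_apply, vertexPt_self, vertexPt_ne S.hne.symm, Finset.sum_eq_zero]
  · simp
  · intro i _
    rw [vertexPt_ne (S.hq' i).symm, mul_zero]

theorem map_other (u : EuclideanSpace ℝ (Fin n)) (s : V) (h : ∀ i, s ≠ S.p i) (hq : s ≠ S.q)
    (hq' : s ≠ S.q') : bipyrMap S.p S.q S.q' u s = 0 := by
  rw [bipyrMap_apply, vertexPt_ne hq, vertexPt_ne hq', Finset.sum_eq_zero]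
  · simp
  · intro i _
    rw [vertexPt_ne (h i), mul_zero]

theorem mem_openRealization {γ : Finset V} (hγ : (γ : Set V) ∈ Γ)
    (hcard : γ.card = n ∨ γ.card = n + 1) (hne : γ.Nonempty) {x : V → ℝ}
    (h1 : ∀ s ∈ γ, 0 < x s) (h2 : ∀ s ∉ γ, x s = 0) (h3 : ∑ s ∈ γ, x s = 1) :
    x ∈ openRealization n Γ := by
  refine Set.mem_biUnion (x := (γ : Set V)) ?_ ((mem_ocvx_vertexPt_iff γ hne x).2 ⟨h1, h2, h3⟩)
  exact ⟨hγ, by simpa [Set.ncard_coe_finset] using hcard⟩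

theorem map_mem {u : EuclideanSpace ℝ (Fin n)} (hu : u ∈ bipyr n) :
    bipyrMap S.p S.q S.q' u ∈ openRealization n Γ := by
  classical
  rw [mem_bipyr S.pos] at hu
  have : Nonempty (Fin n) := ⟨⟨0, S.pos⟩⟩
  have hmin : ∀ i, 0 < min (u i) (mirror u i) := fun i => lt_min (hu i).1 (hu i).2
  have hsum := sum_mirror S.pos u
  have hn : (0 : ℝ) ≤ 2 / (n : ℝ) := by positivity
  have hcard : (Finset.univ.image S.p).card = n := by
    rw [Finset.card_image_of_injective _ S.inj, Finset.card_univ, Fintype.card_fin]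
  have himg : ∑ s ∈ Finset.univ.image S.p, bipyrMap S.p S.q S.q' u s =
      ∑ i, min (u i) (mirror u i) := by
    rw [Finset.sum_image (fun a _ b _ h => S.inj h)]
    exact Finset.sum_congr rfl fun i _ => S.map_p u i
  have hqn : S.q ∉ Finset.univ.image S.p := by
    simpa using S.hq
  have hqn' : S.q' ∉ Finset.univ.image S.p := by
    simpa using S.hq'
  rcases lt_trichotomy (∑ i, u i) 1 with h | h | h
  · have hm : ∀ i, min (u i) (mirror u i) = u i := fun i =>
      min_eq_left (by rw [mirror_eq]; nlinarith)
    refine mem_openRealization (γ := insert S.q (Finset.univ.image S.p)) ?_ ?_ (by simp) ?_ ?_ ?_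
    · simpa using S.face
    · right; rw [Finset.card_insert_of_notMem hqn, hcard]
    · intro s hs
      rcases Finset.mem_insert.1 hs with rfl | hs
      · rw [S.map_q]; simpa using h
      · obtain ⟨i, -, rfl⟩ := Finset.mem_image.1 hs
        rw [S.map_p]; exact hmin i
    · intro s hs
      simp only [Finset.mem_insert, Finset.mem_image, Finset.mem_univ, true_and, not_or,
        not_exists] at hs
      by_cases hs' : s = S.q'
      · rw [hs', S.map_q']; exact max_eq_right (by linarith)
      · exact S.map_other u s (fun i hi => hs.2 i hi.symm) hs.1 hs'
    · rw [Finset.sum_insert hqn, himg, S.map_q, max_eq_left (by linarith)]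
      simp [hm]
  · have hm : ∀ i, min (u i) (mirror u i) = u i := fun i =>
      min_eq_left (by rw [mirror_eq]; nlinarith)
    refine mem_openRealization (γ := Finset.univ.image S.p) ?_ ?_ (by simp) ?_ ?_ ?_
    · simpa using S.crease
    · left; rw [hcard]
    · intro s hs
      obtain ⟨i, -, rfl⟩ := Finset.mem_image.1 hs
      rw [S.map_p]; exact hmin i
    · intro s hs
      simp only [Finset.mem_image, Finset.mem_univ, true_and, not_exists] at hs
      by_cases hs' : s = S.q'
      · rw [hs', S.map_q']; exact max_eq_right (by linarith)
      · by_cases hs'' : s = S.q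
        · rw [hs'', S.map_q]; exact max_eq_right (by linarith)
        · exact S.map_other u s (fun i hi => hs i hi.symm) hs'' hs'
    · rw [himg]
      simp [hm, h]
  · have hm : ∀ i, min (u i) (mirror u i) = mirror u i := fun i =>
      min_eq_right (by rw [mirror_eq]; nlinarith)
    refine mem_openRealization (γ := insert S.q' (Finset.univ.image S.p)) ?_ ?_ (by simp) ?_ ?_ ?_
    · simpa using S.face'
    · right; rw [Finset.card_insert_of_notMem hqn', hcard]
    · intro s hs
      rcases Finset.mem_insert.1 hs with rfl | hs
      · rw [S.map_q']; simpa using h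
      · obtain ⟨i, -, rfl⟩ := Finset.mem_image.1 hs
        rw [S.map_p]; exact hmin i
    · intro s hs
      simp only [Finset.mem_insert, Finset.mem_image, Finset.mem_univ, true_and, not_or,
        not_exists] at hs
      by_cases hs' : s = S.q
      · rw [hs', S.map_q]; exact max_eq_right (by linarith)
      · exact S.map_other u s (fun i hi => hs.2 i hi.symm) hs' hs.1
    · rw [Finset.sum_insert hqn', himg, S.map_q', max_eq_left (by linarith)]
      simp only [hm, hsum]; ring

/-- The inverse of `bipyrMap` in coordinates. -/
noncomputable def coords (x : V → ℝ) : EuclideanSpace ℝ (Fin n) :=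
  WithLp.toLp 2 fun i => x (S.p i) + 2 / (n : ℝ) * x S.q'

theorem coords_map (u : EuclideanSpace ℝ (Fin n)) :
    S.coords (bipyrMap S.p S.q S.q' u) = u := by
  have hn : (0 : ℝ) ≤ 2 / (n : ℝ) := by positivity
  ext i
  simp only [coords, S.map_p, S.map_q']
  rcases le_total (∑ i, u i) 1 with h | h
  · rw [max_eq_right (by linarith), min_eq_left (by rw [mirror_eq]; nlinarith)]
    ring
  · rw [max_eq_left (by linarith), min_eq_right (by rw [mirror_eq]; nlinarith), mirror_eq]
    ring

theorem sum_coords (x : V → ℝ) :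
    ∑ i, S.coords x i = ∑ i, x (S.p i) + 2 * x S.q' := by
  have hn : (n : ℝ) ≠ 0 := by
    have := S.pos
    positivity
  simp only [coords, Finset.sum_add_distrib, Finset.sum_const, Finset.card_univ,
    Fintype.card_fin, nsmul_eq_mul]
  field_simp

theorem mirror_coords (x : V → ℝ) (i : Fin n) :
    mirror (S.coords x) i =
      x (S.p i) + 2 / (n : ℝ) * (1 - ∑ i, x (S.p i) - x S.q') := by
  rw [mirror_eq, S.sum_coords]
  simp only [coords]
  ring

/-- Points of the realization positive on the crease lie in one of the two facets. -/
theorem cases_of_pos {x : V → ℝ} (hx : x ∈ openRealization n Γ) (hp : ∀ i, 0 < x (S.p i)) :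
    (∀ s, (∀ i, s ≠ S.p i) → s ≠ S.q → s ≠ S.q' → x s = 0) ∧
      ((x S.q' = 0 ∧ 0 ≤ x S.q ∧ ∑ i, x (S.p i) + x S.q = 1) ∨
        (x S.q = 0 ∧ 0 < x S.q' ∧ ∑ i, x (S.p i) + x S.q' = 1)) := by
  classical
  obtain ⟨γ, hγ, hxγ⟩ := Set.mem_iUnion₂.1 hx
  obtain ⟨hγΓ, hcard⟩ : γ ∈ Γ ∧ (γ.ncard = n ∨ γ.ncard = n + 1) := hγ
  have hpos := S.pos
  have hcpos : γ.ncard ≠ 0 := by omega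
  have hfin : γ.Finite := Set.finite_of_ncard_ne_zero hcpos
  obtain ⟨t, rfl⟩ := hfin.exists_finset_coe
  have htne : t.Nonempty := by
    rw [Set.ncard_coe_finset] at hcpos
    exact Finset.card_ne_zero.1 hcpos
  obtain ⟨h1, h2, h3⟩ := (mem_ocvx_vertexPt_iff t htne x).1 hxγ
  have hnn : ∀ s, 0 ≤ x s := fun s => by
    by_cases hs : s ∈ t
    · exact (h1 s hs).le
    · exact (h2 s hs).ge
  have hsub : Set.range S.p ⊆ (t : Set V) := by
    rintro _ ⟨i, rfl⟩
    by_contra hs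
    exact (hp i).ne' (h2 _ hs)
  have key : ∀ r : V, (∀ i, S.p i ≠ r) → (t : Set V) ⊆ insert r (Set.range S.p) →
      (∀ s, (∀ i, s ≠ S.p i) → s ≠ r → x s = 0) ∧ ∑ i, x (S.p i) + x r = 1 := by
    intro r hr hrs
    refine ⟨fun s hs hsr => h2 s fun hst => ?_, ?_⟩
    · rcases hrs hst with h | ⟨i, hi⟩
      · exact hsr h
      · exact hs i hi.symm
    · have : ∑ s ∈ t, x s = ∑ s ∈ insert r (Finset.univ.image S.p), x s := by
        refine Finset.sum_subset (fun s hs => ?_) fun s _ hs => h2 s hs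
        have := hrs hs
        simpa using this
      rw [Finset.sum_insert (by simpa using hr), Finset.sum_image (fun a _ b _ h => S.inj h)] at this
      linarith
  rcases S.sub _ hγΓ hsub with h | h
  · obtain ⟨ha, hb⟩ := key S.q S.hq h
    exact ⟨fun s hs hsq _ => ha s hs hsq,
      Or.inl ⟨ha _ (fun i => (S.hq' i).symm) S.hne.symm, hnn _, hb⟩⟩
  · obtain ⟨ha, hb⟩ := key S.q' S.hq' h
    refine ⟨fun s hs _ hsq => ha s hs hsq, ?_⟩
    have hq0 := ha _ (fun i => (S.hq i).symm) S.hne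
    rcases (hnn S.q').lt_or_eq with h0 | h0
    · exact Or.inr ⟨hq0, h0, hb⟩
    · exact Or.inl ⟨h0.symm, hq0.ge, by linarith⟩

theorem coords_mem {x : V → ℝ} (hx : x ∈ openRealization n Γ) (hp : ∀ i, 0 < x (S.p i)) :
    S.coords x ∈ bipyr n := by
  have hn : (0 : ℝ) ≤ 2 / (n : ℝ) := by positivity
  rw [mem_bipyr S.pos]
  intro i
  rw [S.mirror_coords]
  have := hp i
  rcases (S.cases_of_pos hx hp).2 with ⟨h1, h2, h3⟩ | ⟨h1, h2, h3⟩ <;>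
    simp only [coords] <;> constructor <;> nlinarith

theorem map_coords {x : V → ℝ} (hx : x ∈ openRealization n Γ) (hp : ∀ i, 0 < x (S.p i)) :
    bipyrMap S.p S.q S.q' (S.coords x) = x := by
  have hn : (0 : ℝ) ≤ 2 / (n : ℝ) := by positivity
  obtain ⟨h0, hc⟩ := S.cases_of_pos hx hp
  funext s
  by_cases hs : ∃ i, s = S.p i
  · obtain ⟨i, rfl⟩ := hs
    rw [S.map_p, S.mirror_coords]
    rcases hc with ⟨h1, h2, h3⟩ | ⟨h1, h2, h3⟩
    · rw [min_eq_left] <;> simp only [coords, h1]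
      · ring
      · nlinarith
    · have h4 : 1 - ∑ i, x (S.p i) - x S.q' = 0 := by linarith
      rw [h4, mul_zero, add_zero, min_eq_right]
      simp only [coords]
      have := mul_nonneg hn h2.le
      linarith
  · push Not at hs
    by_cases hq : s = S.q
    · rw [hq, S.map_q, S.sum_coords]
      rcases hc with ⟨h1, h2, h3⟩ | ⟨h1, h2, h3⟩
      · rw [max_eq_left (by linarith)]; linarith
      · rw [max_eq_right (by linarith)]; linarith
    · by_cases hq' : s = S.q'
      · rw [hq', S.map_q', S.sum_coords]
        rcases hc with ⟨h1, h2, h3⟩ | ⟨h1, h2, h3⟩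
        · rw [max_eq_right (by linarith)]; linarith
        · rw [max_eq_left (by linarith)]; linarith
      · rw [S.map_other _ s hs hq hq', h0 s hs hq hq']

open Classical in
/-- The chart whose inverse is `bipyrMap` on the bipyramid (the value of the inverse outside the
bipyramid is irrelevant). -/
noncomputable def chart : OpenPartialHomeomorph (openRealization n Γ) (EuclideanSpace ℝ (Fin n)) where
  toFun x := S.coords x
  invFun u := if h : u ∈ bipyr n then ⟨bipyrMap S.p S.q S.q' u, S.map_mem h⟩
    else ⟨_, S.map_mem (center_mem_bipyr S.pos)⟩
  source := {x | ∀ i, 0 < (x : V → ℝ) (S.p i)}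
  target := bipyr n
  map_source' := fun x hx => S.coords_mem x.2 hx
  map_target' := by
    intro u hu
    rw [dif_pos hu]
    intro i
    rw [mem_bipyr S.pos] at hu
    simp only [S.map_p]
    exact lt_min (hu i).1 (hu i).2
  left_inv' := by
    intro x hx
    rw [dif_pos (S.coords_mem x.2 hx)]
    exact Subtype.ext (S.map_coords x.2 hx)
  right_inv' := by
    intro u hu
    rw [dif_pos hu]
    exact S.coords_map u
  open_source := by
    have : {x : openRealization n Γ | ∀ i, 0 < (x : V → ℝ) (S.p i)} =
        ⋂ i, {x : openRealization n Γ | 0 < (x : V → ℝ) (S.p i)} := by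
      ext; simp
    rw [this]
    exact isOpen_iInter_of_finite fun i =>
      isOpen_lt continuous_const ((continuous_apply _).comp continuous_subtype_val)
  open_target := isOpen_bipyr S.pos
  continuousOn_toFun := by
    refine Continuous.continuousOn ?_
    refine (PiLp.continuous_toLp 2 _).comp (continuous_pi fun i => ?_)
    have h : ∀ s : V, Continuous fun x : openRealization n Γ => (x : V → ℝ) s := fun s =>
      (continuous_apply s).comp continuous_subtype_val
    exact (h _).add (continuous_const.mul (h _))
  continuousOn_invFun := by
    rw [continuousOn_iff_continuous_domRestrict, continuous_induced_rng]
    have : (Subtype.val ∘ (bipyr n).domRestrict fun u => if h : u ∈ bipyr n then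
        (⟨bipyrMap S.p S.q S.q' u, S.map_mem h⟩ : openRealization n Γ)
        else ⟨_, S.map_mem (center_mem_bipyr S.pos)⟩) =
        fun u : bipyr n => bipyrMap S.p S.q S.q' u := by
      funext u
      simp
    rw [this]
    exact (continuous_bipyrMap _ _ _).comp continuous_subtype_val

end Star
end Realization


universe v

/-- An alternating `n`-quasigroup with underlying set `A`: an `n`-ary operation for which
`op x = y` is uniquely solvable in each argument, and which is invariant under even permutations
of its arguments. -/
structure AltQuasigroup (n : ℕ) (A : Type v) where
  op : (Fin n → A) → A
  existsUnique_solve : ∀ (i : Fin n) (x : Fin n → A) (y : A),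
    ∃! z : A, op (Function.update x i z) = y
  alternating : ∀ σ ∈ alternatingGroup (Fin n), ∀ x : Fin n → A, op (x ∘ σ) = op x

namespace AltQuasigroup

variable {n : ℕ} {A : Type v} (Q : AltQuasigroup n A)

/-- The tuple `a` commutes. -/
def Commutes (a : Fin n → A) : Prop := ∀ σ : Equiv.Perm (Fin n), Q.op a = Q.op (a ∘ σ)

/-- The set of noncommuting tuples. -/
def NCT : Set (Fin n → A) := {a | ¬ Q.Commutes a}

/-- The vertex set of the facet of `a`: the input vertices `inl (a i)` and the output vertex
`inr (f a)`. -/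
def facet (a : Fin n → A) : Set (A ⊕ A) :=
  insert (Sum.inr (Q.op a)) (Set.range fun i => Sum.inl (a i))

/-- The simplicial complex of the quasigroup: all subsets of the facets of noncommuting tuples. -/
def simplicization : Set (Set (A ⊕ A)) := {γ | ∃ a ∈ Q.NCT, γ ⊆ Q.facet a}

/-- The open serenation as a topological space, with the subspace topology of the product
topology on `ℝ^(A ⊕ A)`. -/
abbrev OSer : Type v := openRealization n Q.simplicization

variable {Q}

theorem two_le_of_mem {a : Fin n → A} (ha : a ∈ Q.NCT) : 2 ≤ n := by
  by_contra h
  apply ha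
  intro σ
  have : Subsingleton (Fin n) := by
    rw [Fin.subsingleton_iff_le_one]; omega
  have : σ = 1 := Subsingleton.elim _ _
  subst this
  rfl

theorem op_eq_or (a : Fin n → A) {σ τ : Equiv.Perm (Fin n)}
    (h : Equiv.Perm.sign σ = Equiv.Perm.sign τ) : Q.op (a ∘ σ) = Q.op (a ∘ τ) := by
  have := Q.alternating (τ⁻¹ * σ) (by
    rw [Equiv.Perm.mem_alternatingGroup]
    simp [h]) (a ∘ τ)
  rw [← this]
  congr 1
  funext i
  simp

theorem op_odd_ne {a : Fin n → A} (ha : a ∈ Q.NCT) {σ : Equiv.Perm (Fin n)}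
    (h : Equiv.Perm.sign σ = -1) : Q.op (a ∘ σ) ≠ Q.op a := by
  intro hσ
  apply ha
  intro τ
  rcases Int.units_eq_one_or (Equiv.Perm.sign τ) with h1 | h1
  · exact (Q.alternating τ (by rwa [Equiv.Perm.mem_alternatingGroup]) a).symm
  · rw [← hσ]
    exact op_eq_or a (h.trans h1.symm)

theorem mem_NCT_of_ne {a : Fin n → A} {σ : Equiv.Perm (Fin n)} (h : Q.op (a ∘ σ) ≠ Q.op a) :
    a ∈ Q.NCT := fun hc => h (hc σ).symm

theorem injective_of_mem {a : Fin n → A} (ha : a ∈ Q.NCT) : Function.Injective a := by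
  intro i j hij
  by_contra hne
  refine op_odd_ne ha (Equiv.Perm.sign_swap hne) ?_
  congr 1
  funext k
  simp only [Function.comp_apply]
  by_cases hki : k = i
  · subst hki; simp [hij]
  · by_cases hkj : k = j
    · subst hkj; simp [hij]
    · rw [Equiv.swap_apply_of_ne_of_ne hki hkj]

theorem solve_unique (i : Fin n) {x y : Fin n → A} (h : ∀ j, j ≠ i → x j = y j)
    (hop : Q.op x = Q.op y) : x = y := by
  have hx : Function.update x i (x i) = x := Function.update_eq_self i x
  have hy : Function.update x i (y i) = y := by
    funext j
    by_cases hj : j = i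
    · subst hj; simp
    · simp [hj, h j hj]
  have := (Q.existsUnique_solve i x (Q.op y)).unique (by rw [hx, hop]) (by rw [hy])
  rw [← hx, this, hy]

/-- The last index. -/
def lastIdx (h : 2 ≤ n) : Fin n := ⟨n - 1, by omega⟩

/-- The last but one index. -/
def penIdx (h : 2 ≤ n) : Fin n := ⟨n - 2, by omega⟩

theorem pen_ne_last (h : 2 ≤ n) : penIdx h ≠ lastIdx h := by
  intro h'
  have : n - 2 = n - 1 := congrArg Fin.val h'
  omega

/-- The tuple `a'` obtained from `a` by swapping its last two entries. -/
def swapTuple (h : 2 ≤ n) (a : Fin n → A) : Fin n → A :=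
  a ∘ Equiv.swap (penIdx h) (lastIdx h)

variable (Q) in
/-- The unique `z` (called `a_{n+1}`) with
`f (a_1, …, a_{n-2}, z, a_{n-1}) = f (a_1, …, a_n)`. -/
noncomputable def extra (h : 2 ≤ n) (a : Fin n → A) : A :=
  (Q.existsUnique_solve (penIdx h) (swapTuple h a) (Q.op a)).choose

theorem op_extra (h : 2 ≤ n) (a : Fin n → A) :
    Q.op (Function.update (swapTuple h a) (penIdx h) (Q.extra h a)) = Q.op a :=
  (Q.existsUnique_solve (penIdx h) (swapTuple h a) (Q.op a)).choose_spec.1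

theorem swapTuple_last (h : 2 ≤ n) (a : Fin n → A) : swapTuple h a (lastIdx h) = a (penIdx h) := by
  simp [swapTuple]

theorem swapTuple_of_ne (h : 2 ≤ n) (a : Fin n → A) {i : Fin n} (h1 : i ≠ penIdx h)
    (h2 : i ≠ lastIdx h) : swapTuple h a i = a i := by
  simp [swapTuple, Equiv.swap_apply_of_ne_of_ne h1 h2]

theorem op_swapTuple_ne {a : Fin n → A} (ha : a ∈ Q.NCT) (h : 2 ≤ n) :
    Q.op (swapTuple h a) ≠ Q.op a :=
  op_odd_ne ha (Equiv.Perm.sign_swap (pen_ne_last h))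

theorem mem_NCT_comp {a : Fin n → A} (ha : a ∈ Q.NCT) (σ : Equiv.Perm (Fin n)) :
    a ∘ σ ∈ Q.NCT := by
  intro hc
  apply ha
  intro τ
  have h1 := hc σ⁻¹
  have h2 := hc (σ⁻¹ * τ)
  have e1 : (a ∘ σ) ∘ (σ⁻¹ : Equiv.Perm (Fin n)) = a := by funext i; simp
  have e2 : (a ∘ σ) ∘ (σ⁻¹ * τ : Equiv.Perm (Fin n)) = a ∘ τ := by funext i; simp
  rw [e1] at h1
  rw [e2] at h2
  rw [← h1, h2]

theorem extra_ne_last {a : Fin n → A} (ha : a ∈ Q.NCT) (h : 2 ≤ n) :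
    Q.extra h a ≠ a (lastIdx h) := by
  intro he
  apply op_swapTuple_ne ha h
  have := op_extra (Q := Q) h a
  rw [he] at this
  rw [← this]
  congr 1
  symm
  rw [Function.update_eq_self_iff]
  simp [swapTuple]

/-- Replacing an entry of a swapped tuple so that the value is unchanged gives a noncommuting
tuple. -/
theorem update_mem_NCT {a : Fin n → A} (ha : a ∈ Q.NCT) {i j : Fin n} (hij : i ≠ j) {z : A}
    (hz : Q.op (Function.update (a ∘ Equiv.swap i j) i z) = Q.op a) :
    Function.update (a ∘ Equiv.swap i j) i z ∈ Q.NCT := by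
  refine mem_NCT_of_ne (σ := Equiv.swap i j) ?_
  rw [hz]
  intro hop
  have : (Function.update (a ∘ Equiv.swap i j) i z) ∘ Equiv.swap i j = a := by
    refine solve_unique j (fun k hk => ?_) hop
    have hk' : Equiv.swap i j k ≠ i := by
      intro h
      apply hk
      have := congrArg (Equiv.swap i j) h
      simpa using this
    simp [hk']
  have h2 : Function.update (a ∘ Equiv.swap i j) i z = a ∘ Equiv.swap i j := by
    funext k
    have h3 := congrFun this (Equiv.swap i j k)
    simp only [Function.comp_apply, Equiv.swap_apply_self] at h3
    exact h3
  rw [h2] at hz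
  exact op_odd_ne ha (Equiv.Perm.sign_swap hij) hz

theorem extra_mem_NCT {a : Fin n → A} (ha : a ∈ Q.NCT) (h : 2 ≤ n) :
    Function.update (swapTuple h a) (penIdx h) (Q.extra h a) ∈ Q.NCT :=
  update_mem_NCT ha (pen_ne_last h) (op_extra h a)

theorem extra_ne {a : Fin n → A} (ha : a ∈ Q.NCT) (h : 2 ≤ n) {i : Fin n} (hi : i ≠ lastIdx h) :
    Q.extra h a ≠ a i := by
  have hinj := injective_of_mem (extra_mem_NCT ha h)
  intro he
  by_cases hip : i = penIdx h
  · have := @hinj (penIdx h) (lastIdx h) (by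
      rw [Function.update_self, Function.update_of_ne (pen_ne_last h).symm, swapTuple_last, he, hip])
    exact pen_ne_last h this
  · have := @hinj (penIdx h) i (by
      rw [Function.update_self, Function.update_of_ne hip, swapTuple_of_ne h a hip hi, he])
    exact hip this.symm

/-- A tuple extending to a permutation of another one off one index. -/
theorem exists_perm {a b : Fin n → A} (ha : Function.Injective a) (s : Set (Fin n))
    (hs : ∀ i ∈ s, ∃ j, b j = a i) : ∃ σ : Equiv.Perm (Fin n), ∀ i ∈ s, b (σ i) = a i := by
  classical
  choose! g hg using hs
  have hinj : Set.InjOn g s := by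
    intro i hi j hj hij
    apply ha
    rw [← hg i hi, ← hg j hj, hij]
  obtain ⟨σ, hσ⟩ := Set.MapsTo.exists_equiv_extend_of_card_eq (α := Fin n) (s := s)
    (t := Finset.univ) (by simp) (f := g) (by intro x _; simp) hinj
  refine ⟨σ.trans (Equiv.subtypeUnivEquiv (by simp)), fun i hi => ?_⟩
  have := hσ i hi
  simp only [Equiv.trans_apply, Equiv.subtypeUnivEquiv_apply]
  rw [this, hg i hi]

/-- The two facets at the face of input vertices of `a`. -/
def inputStar (a : Q.NCT) : Star n Q.simplicization where
  p i := Sum.inl (a.1 i)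
  q := Sum.inr (Q.op a.1)
  q' := Sum.inr (Q.op (swapTuple (two_le_of_mem a.2) a.1))
  pos := (two_le_of_mem a.2).trans' (by norm_num)
  inj := Sum.inl_injective.comp (injective_of_mem a.2)
  hq i := by simp
  hq' i := by simp
  hne h := op_swapTuple_ne a.2 (two_le_of_mem a.2) (Sum.inr_injective h).symm
  crease := ⟨a.1, a.2, Set.subset_insert _ _⟩
  face := ⟨a.1, a.2, subset_rfl⟩
  face' := by
    refine ⟨swapTuple (two_le_of_mem a.2) a.1, mem_NCT_comp a.2 _, ?_⟩
    refine Set.insert_subset_insert ?_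
    rintro _ ⟨i, rfl⟩
    exact ⟨Equiv.swap (penIdx (two_le_of_mem a.2)) (lastIdx (two_le_of_mem a.2)) i,
      by simp [swapTuple]⟩
  sub := by
    rintro γ ⟨b, hb, hγ⟩ hp
    obtain ⟨σ, hσ⟩ := exists_perm (b := b) (injective_of_mem a.2) Set.univ (by
      intro i _
      rcases hγ (hp ⟨i, rfl⟩) with h | ⟨j, hj⟩
      · cases h
      · exact ⟨j, Sum.inl_injective hj⟩)
    have hba : b = a.1 ∘ (σ⁻¹ : Equiv.Perm (Fin n)) := by
      funext i
      have := hσ (σ⁻¹ i) trivial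
      simpa using this
    have hr : Set.range (fun i => (Sum.inl (b i) : A ⊕ A)) ⊆ Set.range fun i => Sum.inl (a.1 i) := by
      rintro _ ⟨i, rfl⟩
      exact ⟨σ⁻¹ i, by rw [hba]; rfl⟩
    rcases Int.units_eq_one_or (Equiv.Perm.sign σ⁻¹) with h1 | h1
    · left
      have : Q.op b = Q.op a.1 := by
        rw [hba]; exact Q.alternating _ (by rwa [Equiv.Perm.mem_alternatingGroup]) _
      rw [← this]
      exact hγ.trans (Set.insert_subset_insert hr)
    · right
      have : Q.op b = Q.op (swapTuple (two_le_of_mem a.2) a.1) := by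
        rw [hba]
        exact op_eq_or _ (h1.trans (Equiv.Perm.sign_swap (pen_ne_last _)).symm)
      rw [← this]
      exact hγ.trans (Set.insert_subset_insert hr)

/-- The two facets at the face of `a_1, …, a_{n-1}` and `f a`. -/
noncomputable def outputStar (a : Q.NCT) : Star n Q.simplicization where
  p i := if i = lastIdx (two_le_of_mem a.2) then Sum.inr (Q.op a.1) else Sum.inl (a.1 i)
  q := Sum.inl (a.1 (lastIdx (two_le_of_mem a.2)))
  q' := Sum.inl (Q.extra (two_le_of_mem a.2) a.1)
  pos := (two_le_of_mem a.2).trans' (by norm_num)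
  inj := by
    intro i j hij
    have hinj := injective_of_mem a.2
    dsimp only at hij
    split_ifs at hij with h1 h2 h2
    · rw [h1, h2]
    · exact hinj (Sum.inl_injective hij)
  hq i := by
    split_ifs with h
    · simp
    · exact fun h' => h (injective_of_mem a.2 (Sum.inl_injective h'))
  hq' i := by
    split_ifs with h
    · simp
    · exact fun h' => extra_ne a.2 _ h (Sum.inl_injective h').symm
  hne h := extra_ne_last a.2 _ (Sum.inl_injective h).symm
  crease := by
    refine ⟨a.1, a.2, ?_⟩
    rintro _ ⟨i, rfl⟩
    dsimp only
    split_ifs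
    · exact Or.inl rfl
    · exact Or.inr ⟨i, rfl⟩
  face := by
    refine ⟨a.1, a.2, ?_⟩
    rintro _ (rfl | ⟨i, rfl⟩)
    · exact Or.inr ⟨_, rfl⟩
    · dsimp only
      split_ifs
      · exact Or.inl rfl
      · exact Or.inr ⟨i, rfl⟩
  face' := by
    have h2 := two_le_of_mem a.2
    refine ⟨_, extra_mem_NCT a.2 h2, ?_⟩
    rintro _ (rfl | ⟨i, rfl⟩)
    · exact Or.inr ⟨penIdx h2, by simp⟩
    · dsimp only
      split_ifs with h
      · left
        rw [op_extra]
      · right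
        by_cases hp : i = penIdx h2
        · refine ⟨lastIdx h2, ?_⟩
          simp only
          rw [Function.update_of_ne (pen_ne_last h2).symm, swapTuple_last, hp]
        · refine ⟨i, ?_⟩
          simp only
          rw [Function.update_of_ne hp, swapTuple_of_ne h2 _ hp h]
  sub := by
    have h2 := two_le_of_mem a.2
    rintro γ ⟨b, hb, hγ⟩ hp
    have hop : Q.op b = Q.op a.1 := by
      rcases hγ (hp ⟨lastIdx h2, rfl⟩) with h | ⟨j, hj⟩
      · simp only [if_true] at h
        exact (Sum.inr_injective h).symm
      · simp at hj
    obtain ⟨σ, hσ⟩ := exists_perm (b := b) (injective_of_mem a.2) {i | i ≠ lastIdx h2} (by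
      intro i hi
      have hi : i ≠ lastIdx h2 := hi
      rcases hγ (hp ⟨i, rfl⟩) with h | ⟨j, hj⟩
      · simp [hi] at h
      · simp only [if_neg hi] at hj
        exact ⟨j, Sum.inl_injective hj⟩)
    have hσ' : ∀ i, i ≠ lastIdx h2 → b (σ i) = a.1 i := fun i hi => hσ i hi
    have hlast : ∀ r : A, b (σ (lastIdx h2)) = r → γ ⊆ insert (Sum.inl r) (Set.range fun i =>
        if i = lastIdx h2 then Sum.inr (Q.op a.1) else Sum.inl (a.1 i)) := by
      intro r hr s hs
      rcases hγ hs with h | ⟨j, hj⟩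
      · exact Or.inr ⟨lastIdx h2, by simp [h, hop]⟩
      · obtain ⟨k, rfl⟩ := σ.surjective j
        by_cases hk : k = lastIdx h2
        · left; rw [← hj, ← hr, hk]
        · right; exact ⟨k, by simp only [if_neg hk]; rw [← hj, ← hσ' k hk]⟩
    rcases Int.units_eq_one_or (Equiv.Perm.sign σ) with h1 | h1
    · left
      refine hlast _ ?_
      have : b ∘ σ = a.1 := by
        refine solve_unique (Q := Q) (lastIdx h2) hσ' ?_
        rw [Q.alternating _ (by rwa [Equiv.Perm.mem_alternatingGroup]), hop]
      exact congrFun this _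
    · right
      refine hlast _ ?_
      have h3 : Q.op (swapTuple h2 (b ∘ σ)) = Q.op b := by
        have := Q.alternating (σ * Equiv.swap (penIdx h2) (lastIdx h2)) (by
          rw [Equiv.Perm.mem_alternatingGroup]
          simp [h1, Equiv.Perm.sign_swap (pen_ne_last h2)]) b
        rw [← this]; rfl
      have : swapTuple h2 (b ∘ σ) =
          Function.update (swapTuple h2 a.1) (penIdx h2) (Q.extra h2 a.1) := by
        refine solve_unique (Q := Q) (penIdx h2) (fun k hk => ?_) (by rw [h3, hop, op_extra])
        rw [Function.update_of_ne hk]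
        by_cases hkl : k = lastIdx h2
        · rw [hkl, swapTuple_last, swapTuple_last]
          exact hσ' _ (pen_ne_last h2)
        · rw [swapTuple_of_ne h2 _ hk hkl, swapTuple_of_ne h2 _ hk hkl]
          exact hσ' k hkl
      have := congrFun this (penIdx h2)
      simpa [swapTuple] using this

/-- The inverse of the serene chart of input type for `a`. Its domain is the open star of the face
of input vertices of `a`, its target is the bipyramid. -/
noncomputable def inputChart (a : Q.NCT) :
    OpenPartialHomeomorph Q.OSer (EuclideanSpace ℝ (Fin n)) := (inputStar a).chart

/-- The inverse of the serene chart of output type for `a`. -/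
noncomputable def outputChart (a : Q.NCT) :
    OpenPartialHomeomorph Q.OSer (EuclideanSpace ℝ (Fin n)) := (outputStar a).chart

variable (Q) in
/-- The atlas of serene charts. -/
def sereneAtlas : Set (OpenPartialHomeomorph Q.OSer (EuclideanSpace ℝ (Fin n))) :=
  ⋃ a : Q.NCT, {inputChart a, outputChart a}

theorem exists_chart (x : Q.OSer) : ∃ e ∈ sereneAtlas Q, x ∈ e.source := by
  obtain ⟨x, hx⟩ := x
  obtain ⟨γ, hγ, hxγ⟩ := Set.mem_iUnion₂.1 hx
  obtain ⟨⟨a, ha, hγa⟩, hcard⟩ : γ ∈ Q.simplicization ∧ (γ.ncard = n ∨ γ.ncard = n + 1) := hγ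
  have h2 := two_le_of_mem ha
  have hainj := injective_of_mem ha
  have hfin : γ.Finite := Set.finite_of_ncard_ne_zero (by omega)
  have hpos : ∀ s ∈ γ, 0 < x s := by
    obtain ⟨t, rfl⟩ := hfin.exists_finset_coe
    have htne : t.Nonempty := by
      rw [Set.ncard_coe_finset] at hcard
      exact Finset.card_pos.1 (by omega)
    exact ((mem_ocvx_vertexPt_iff t htne x).1 hxγ).1
  by_cases hin : ∀ i, Sum.inl (a i) ∈ γ
  · refine ⟨inputChart ⟨a, ha⟩, Set.mem_iUnion.2 ⟨⟨a, ha⟩, Or.inl rfl⟩, ?_⟩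
    exact fun i => hpos _ (hin i)
  · push Not at hin
    obtain ⟨i, hi⟩ := hin
    have hsub : γ ⊆ insert (Sum.inr (Q.op a)) ((fun j => Sum.inl (a j)) '' {j | j ≠ i}) := by
      intro s hs
      rcases hγa hs with h | ⟨j, rfl⟩
      · exact Or.inl h
      · refine Or.inr ⟨j, fun h => hi (h ▸ hs), rfl⟩
    have hc : (insert (Sum.inr (Q.op a))
        ((fun j => (Sum.inl (a j) : A ⊕ A)) '' {j | j ≠ i})).ncard ≤ n := by
      refine (Set.ncard_insert_le _ _).trans ?_
      rw [Set.ncard_image_of_injective (f := fun j => (Sum.inl (a j) : A ⊕ A)) _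
        (Sum.inl_injective.comp hainj)]
      have : {j : Fin n | j ≠ i} = ((Finset.univ.erase i : Finset (Fin n)) : Set (Fin n)) := by
        ext; simp
      rw [this, Set.ncard_coe_finset, Finset.card_erase_of_mem (Finset.mem_univ i)]
      simp
      omega
    have hγeq := Set.eq_of_subset_of_ncard_le hsub (by omega) (Set.toFinite _)
    have hout : 0 < x (Sum.inr (Q.op a)) := hpos _ (by rw [hγeq]; exact Or.inl rfl)
    have hinp : ∀ j, j ≠ i → 0 < x (Sum.inl (a j)) := fun j hj =>
      hpos _ (by rw [hγeq]; exact Or.inr ⟨j, hj, rfl⟩)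
    obtain ⟨b, hb, hbop, hbj⟩ : ∃ b ∈ Q.NCT, Q.op b = Q.op a ∧
        ∀ j, j ≠ lastIdx h2 → 0 < x (Sum.inl (b j)) := by
      by_cases hil : i = lastIdx h2
      · exact ⟨a, ha, rfl, fun j hj => hinp j (by rwa [hil])⟩
      · obtain ⟨z, hz, -⟩ := Q.existsUnique_solve (lastIdx h2)
          (a ∘ Equiv.swap (lastIdx h2) i) (Q.op a)
        refine ⟨_, update_mem_NCT ha (Ne.symm hil) hz, hz, fun j hj => ?_⟩
        rw [Function.update_of_ne hj]
        refine hinp _ fun h => hj ?_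
        have := congrArg (Equiv.swap (lastIdx h2) i) h
        simpa using this
    refine ⟨outputChart ⟨b, hb⟩, Set.mem_iUnion.2 ⟨⟨b, hb⟩, Or.inr rfl⟩, ?_⟩
    intro j
    show 0 < x (if j = lastIdx _ then Sum.inr (Q.op b) else Sum.inl (b j))
    split_ifs with h
    · rwa [hbop]
    · exact hbj j h

noncomputable instance : ChartedSpace (EuclideanSpace ℝ (Fin n)) Q.OSer where
  atlas := sereneAtlas Q
  chartAt x := (exists_chart x).choose
  mem_chart_source x := (exists_chart x).choose_spec.2
  chart_mem_atlas x := (exists_chart x).choose_spec.1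

end AltQuasigroup


section Curvature

variable {n : ℕ}

/-- The partial derivative `∂_i φ` at `u`. -/
noncomputable def partialDeriv (i : Fin n) (φ : EuclideanSpace ℝ (Fin n) → ℝ)
    (u : EuclideanSpace ℝ (Fin n)) : ℝ :=
  fderiv ℝ φ u (EuclideanSpace.single i 1)

/-- The Christoffel symbol `Γ^k_{ij}` of the matrix `G` of metric coefficients. -/
noncomputable def christoffel (G : EuclideanSpace ℝ (Fin n) → Matrix (Fin n) (Fin n) ℝ)
    (k i j : Fin n) (u : EuclideanSpace ℝ (Fin n)) : ℝ :=
  1 / 2 * ∑ l, (G u)⁻¹ k l *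
    (partialDeriv i (fun w => G w j l) u + partialDeriv j (fun w => G w i l) u -
      partialDeriv l (fun w => G w i j) u)

/-- The component `R^l_{kij}` of the Riemann curvature tensor of the matrix `G` of metric
coefficients. -/
noncomputable def riemannCurvature (G : EuclideanSpace ℝ (Fin n) → Matrix (Fin n) (Fin n) ℝ)
    (l k i j : Fin n) (u : EuclideanSpace ℝ (Fin n)) : ℝ :=
  partialDeriv i (christoffel G l j k) u - partialDeriv j (christoffel G l i k) u +
    ∑ m, (christoffel G l i m u * christoffel G m j k u -
      christoffel G l j m u * christoffel G m i k u)

variable {M : Type*} [TopologicalSpace M] [ChartedSpace (EuclideanSpace ℝ (Fin n)) M]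

variable (n M) in
/-- Fields of bilinear forms on the tangent spaces of `M`. -/
abbrev BilinField : Type _ :=
  ∀ x : M, TangentSpace 𝓘(ℝ, EuclideanSpace ℝ (Fin n)) x →L[ℝ]
    TangentSpace 𝓘(ℝ, EuclideanSpace ℝ (Fin n)) x →L[ℝ] ℝ

/-- The `k`-th coordinate tangent vector of the chart `e` at the point with coordinates `u`. -/
noncomputable def coordVec (e : OpenPartialHomeomorph M (EuclideanSpace ℝ (Fin n)))
    (u : EuclideanSpace ℝ (Fin n)) (k : Fin n) :
    TangentSpace 𝓘(ℝ, EuclideanSpace ℝ (Fin n)) (e.symm u) :=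
  mfderiv 𝓘(ℝ, EuclideanSpace ℝ (Fin n)) 𝓘(ℝ, EuclideanSpace ℝ (Fin n)) e.symm u
    (EuclideanSpace.single k (1 : ℝ) : EuclideanSpace ℝ (Fin n))

/-- The matrix of `g` in the chart `e`. -/
noncomputable def metricMatrix (g : BilinField n M)
    (e : OpenPartialHomeomorph M (EuclideanSpace ℝ (Fin n))) (u : EuclideanSpace ℝ (Fin n)) :
    Matrix (Fin n) (Fin n) ℝ :=
  Matrix.of fun i j => g (e.symm u) (coordVec e u i) (coordVec e u j)

/-- `g` is flat: its Riemann curvature tensor vanishes at every point, in the coordinates of every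
chart of the atlas. -/
def IsFlat (g : BilinField n M) : Prop :=
  ∀ e ∈ atlas (EuclideanSpace ℝ (Fin n)) M, ∀ u ∈ e.target, ∀ l k i j : Fin n,
    riemannCurvature (metricMatrix g e) l k i j u = 0

end Curvature

namespace AltQuasigroup

variable {n : ℕ} {A : Type*} {Q : AltQuasigroup n A}

/-- The vertex set `{a_1, …, a_n}` (inputs) of the face shared by the facets of `a` and `a'`. -/
def inputFace (a : Q.NCT) : Set (A ⊕ A) := Set.range fun i => Sum.inl (a.1 i)

/-- The vertex set of the face spanned by the inputs `a_1, …, a_{n-1}` and the output `f a`. -/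
def outputFace (a : Q.NCT) : Set (A ⊕ A) :=
  insert (Sum.inr (Q.op a.1))
    ((fun i => Sum.inl (a.1 i)) '' {i | i ≠ lastIdx (two_le_of_mem a.2)})

/-- The tangent vector `v` at `x`, a point of an open facet, is the vector `w` of the ambient space
`ℝ^(A ⊕ A)`: the derivative of each ambient coordinate along `v` is that coordinate of `w`. -/
def IsAmbient (x : Q.OSer) (v : TangentSpace 𝓘(ℝ, EuclideanSpace ℝ (Fin n)) x)
    (w : A ⊕ A → ℝ) : Prop :=
  ∀ s : A ⊕ A, mfderiv 𝓘(ℝ, EuclideanSpace ℝ (Fin n)) 𝓘(ℝ, ℝ)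
    (fun y : Q.OSer => (y : A ⊕ A → ℝ) s) x v = w s

/-- The rules defining the standard metric. On an open facet tangent vectors are vectors of the
ambient space. On an open face with `n` vertices the tangent space has the vertices of the face as
a basis, the `k`-th vertex being identified with the `k`-th coordinate vector of the serene chart
around that face; for `outputChart a` the first `n - 1` vertices are the inputs
`a_1, …, a_{n-1}` and the `n`-th one is the output `f a`. -/
structure IsStandardMetric (g : BilinField n Q.OSer) : Prop where
  facet : ∀ (a : Q.NCT) (x : Q.OSer), (x : A ⊕ A → ℝ) ∈ ocvx (vertexPt '' Q.facet a.1) →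
    ∀ (i j : Fin n) (v w : TangentSpace 𝓘(ℝ, EuclideanSpace ℝ (Fin n)) x),
      IsAmbient x v (vertexPt (Sum.inl (a.1 i)) - vertexPt (Sum.inr (Q.op a.1))) →
      IsAmbient x w (vertexPt (Sum.inl (a.1 j)) - vertexPt (Sum.inr (Q.op a.1))) →
      g x v w = 1 + if i = j then 1 else 0
  output : ∀ (a : Q.NCT), ∀ u ∈ bipyr n,
    ((outputChart a).symm u : A ⊕ A → ℝ) ∈ ocvx (vertexPt '' outputFace a) → ∀ i j : Fin n,
      g ((outputChart a).symm u) (coordVec (outputChart a) u i) (coordVec (outputChart a) u j) =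
        1 + if i = j then 1 else 0
  input : ∀ (a : Q.NCT), ∀ u ∈ bipyr n,
    ((inputChart a).symm u : A ⊕ A → ℝ) ∈ ocvx (vertexPt '' inputFace a) → ∀ i j : Fin n,
      g ((inputChart a).symm u) (coordVec (inputChart a) u i) (coordVec (inputChart a) u j) =
        1 + if i = j then 1 else 0

end AltQuasigroup

end Serenation

/-! The matrix `J + I` is the Gram matrix of the edge vectors issuing from one vertex of a standard
n-simplex. The form it defines, `simplexForm`, does not depend on that vertex: in barycentric
components, which sum to zero, it is the ordinary dot product, so every permutation of the n+1
vertices preserves it (`simplexForm_permDir`). The linear part of the reflection in the hyperplane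
`∑ u = 1`, which exchanges the two halves of the bipyramid, preserves it as well
(`simplexForm_mirrorDir`).

The quasigroup enters the comparison of charts only through `Star`: a crease of n vertices that lies
in exactly two facets. If two chart domains overlap, either the creases coincide, and the charts
differ by a reordering of the crease and possibly a reflection; or the creases differ, the overlap
lies in a single open facet, and after reflections the charts differ by a permutation of barycentric
coordinates. So every transition map is affine with linear part an isometry of `simplexForm`
(`Star.compatible`). Hence the atlas is smooth, the form is well defined and has matrix `J + I` in
every chart, and the curvature vanishes because these coefficients are constant.

Rules 1–3 prescribe the form on a basis of each tangent space, which gives uniqueness. A face with n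
vertices is the crease of any serene chart around its points. A face with n+1 vertices is a facet,
where the ambient edge vectors are the coordinate vectors of the input chart.

For second countability, a crease determines its two apexes, so a countable vertex set can be closed
under adjoining apexes while staying countable. The points supported on it form a clopen set that
embeds in a countable product of lines. -/

namespace Serenation

/-! ### The form `J + I` and its linear isometries -/

section SimplexForm

variable {n : ℕ}

variable (n) in
/-- The bilinear form with matrix `J + I`: the inner product of the edge vectors at a vertex of a
standard simplex. -/
noncomputable def simplexForm :
    EuclideanSpace ℝ (Fin n) →L[ℝ] EuclideanSpace ℝ (Fin n) →L[ℝ] ℝ :=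
  ∑ i, (EuclideanSpace.proj (𝕜 := ℝ) i).smulRight (EuclideanSpace.proj (𝕜 := ℝ) i) +
    (∑ i, EuclideanSpace.proj (𝕜 := ℝ) i).smulRight (∑ i, EuclideanSpace.proj (𝕜 := ℝ) i)

theorem simplexForm_apply (u v : EuclideanSpace ℝ (Fin n)) :
    simplexForm n u v = ∑ i, u i * v i + (∑ i, u i) * ∑ i, v i := by
  simp [simplexForm]

theorem simplexForm_symm (u v : EuclideanSpace ℝ (Fin n)) :
    simplexForm n u v = simplexForm n v u := by
  simp only [simplexForm_apply, mul_comm]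

theorem norm_sq_le_simplexForm (u : EuclideanSpace ℝ (Fin n)) :
    ‖u‖ ^ 2 ≤ simplexForm n u u := by
  rw [simplexForm_apply, EuclideanSpace.real_norm_sq_eq]
  simp only [sq]
  nlinarith [mul_self_nonneg (∑ i, u i)]

theorem simplexForm_pos {u : EuclideanSpace ℝ (Fin n)} (hu : u ≠ 0) : 0 < simplexForm n u u :=
  (pow_pos (norm_pos_iff.2 hu) 2).trans_le (norm_sq_le_simplexForm u)

theorem simplexForm_single (i j : Fin n) :
    simplexForm n (EuclideanSpace.single i 1) (EuclideanSpace.single j 1) =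
      1 + if i = j then 1 else 0 := by
  simp [simplexForm_apply, PiLp.single_apply, eq_comm, add_comm]

/-- The barycentric components of a direction: the components of `u` and minus their sum. -/
def baryDir (u : EuclideanSpace ℝ (Fin n)) (o : Option (Fin n)) : ℝ :=
  o.elim (-∑ i, u i) fun i => u i

theorem sum_baryDir (u : EuclideanSpace ℝ (Fin n)) : ∑ o, baryDir u o = 0 := by
  simp [Fintype.sum_option, baryDir]

/-- The term `(∑ u) * (∑ v)` is the contribution of the component at `none`. This makes the symmetry
among all n+1 vertices visible, whereas the coordinates `u i` single out one of them. -/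
theorem simplexForm_eq_sum_baryDir (u v : EuclideanSpace ℝ (Fin n)) :
    simplexForm n u v = ∑ o, baryDir u o * baryDir v o := by
  simp [Fintype.sum_option, baryDir, simplexForm_apply, add_comm]

/-- The linear map permuting the barycentric components. -/
noncomputable def permDir (π : Equiv.Perm (Option (Fin n))) :
    EuclideanSpace ℝ (Fin n) →L[ℝ] EuclideanSpace ℝ (Fin n) :=
  LinearMap.toContinuousLinearMap
    { toFun := fun u => WithLp.toLp 2 fun i => baryDir u (π (some i))
      map_add' := by
        intro u v
        ext i
        rcases h : π (some i) with _ | j <;> simp [h, baryDir, Finset.sum_add_distrib]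
        ring
      map_smul' := by
        intro c u
        ext i
        rcases h : π (some i) with _ | j <;> simp [h, baryDir, Finset.mul_sum] }

theorem permDir_apply (π : Equiv.Perm (Option (Fin n))) (u : EuclideanSpace ℝ (Fin n))
    (i : Fin n) : permDir π u i = baryDir u (π (some i)) := rfl

/-- Only the component at `none` needs an argument: a permutation keeps the total zero, so that
component is forced by the others. -/
theorem baryDir_permDir (π : Equiv.Perm (Option (Fin n))) (u : EuclideanSpace ℝ (Fin n))
    (o : Option (Fin n)) : baryDir (permDir π u) o = baryDir u (π o) := by
  rcases o with _ | i
  · have h := Equiv.sum_comp π (baryDir u)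
    rw [sum_baryDir, Fintype.sum_option] at h
    simp only [baryDir, Option.elim_none, permDir_apply] at h ⊢
    linarith
  · rfl

theorem simplexForm_permDir (π : Equiv.Perm (Option (Fin n))) (u v : EuclideanSpace ℝ (Fin n)) :
    simplexForm n (permDir π u) (permDir π v) = simplexForm n u v := by
  simp only [simplexForm_eq_sum_baryDir, baryDir_permDir]
  exact Equiv.sum_comp π fun o => baryDir u o * baryDir v o

variable (n) in
/-- The linear part of the reflection `mirror`. -/
noncomputable def mirrorDir : EuclideanSpace ℝ (Fin n) →L[ℝ] EuclideanSpace ℝ (Fin n) :=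
  ContinuousLinearMap.id ℝ _ - (∑ i, EuclideanSpace.proj (𝕜 := ℝ) i).smulRight
    (WithLp.toLp 2 fun _ => 2 / (n : ℝ))

theorem mirrorDir_apply (u : EuclideanSpace ℝ (Fin n)) (i : Fin n) :
    mirrorDir n u i = u i - (∑ j, u j) * (2 / (n : ℝ)) := by
  simp [mirrorDir]

/-- The map is the orthogonal reflection along `(1, …, 1)`: it preserves the dot product and negates
the coordinate sum, so both summands of the form are unchanged. -/
theorem simplexForm_mirrorDir (hn : 1 ≤ n) (u v : EuclideanSpace ℝ (Fin n)) :
    simplexForm n (mirrorDir n u) (mirrorDir n v) = simplexForm n u v := by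
  have hn : (n : ℝ) ≠ 0 := by positivity
  have hs : ∀ w : EuclideanSpace ℝ (Fin n), ∑ i, mirrorDir n w i = -∑ i, w i := by
    intro w
    simp only [mirrorDir_apply, Finset.sum_sub_distrib, Finset.sum_const, Finset.card_univ,
      Fintype.card_fin, nsmul_eq_mul]
    field_simp
    ring
  have hm : ∑ i, mirrorDir n u i * mirrorDir n v i = ∑ i, u i * v i := by
    have : ∀ i, mirrorDir n u i * mirrorDir n v i = u i * v i - (∑ j, v j) * (2 / (n : ℝ)) * u i -
        (∑ j, u j) * (2 / (n : ℝ)) * v i +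
          (∑ j, u j) * (2 / (n : ℝ)) * ((∑ j, v j) * (2 / (n : ℝ))) := by
      intro i
      simp only [mirrorDir_apply]
      ring
    simp only [this, Finset.sum_add_distrib, Finset.sum_sub_distrib, ← Finset.mul_sum,
      Finset.sum_const, Finset.card_univ, Fintype.card_fin, nsmul_eq_mul]
    field_simp
    ring
  rw [simplexForm_apply, simplexForm_apply, hm, hs, hs, neg_mul_neg]

/-- Positive definiteness gives injectivity, and finite dimension does the rest. In particular such
a map carries the standard basis to a basis. -/
theorem bijective_of_simplexForm_eq {L : EuclideanSpace ℝ (Fin n) →L[ℝ] EuclideanSpace ℝ (Fin n)}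
    (hL : ∀ u v, simplexForm n (L u) (L v) = simplexForm n u v) : Function.Bijective L := by
  have hinj : Function.Injective L := by
    refine (injective_iff_map_eq_zero L).2 fun u hu => ?_
    by_contra hne
    have h := simplexForm_pos hne
    rw [← hL, hu] at h
    simp at h
  exact ⟨hinj, LinearMap.surjective_of_injective (f := L.toLinearMap) hinj⟩

/-- A bilinear form that takes the values of `simplexForm` on the image of the standard basis
under a `simplexForm`-preserving map is `simplexForm`. -/
theorem eq_simplexForm {L : EuclideanSpace ℝ (Fin n) →L[ℝ] EuclideanSpace ℝ (Fin n)}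
    (hL : ∀ u v, simplexForm n (L u) (L v) = simplexForm n u v)
    {h : EuclideanSpace ℝ (Fin n) →L[ℝ] EuclideanSpace ℝ (Fin n) →L[ℝ] ℝ}
    (hh : ∀ i j, h (L (EuclideanSpace.single i 1)) (L (EuclideanSpace.single j 1)) =
      1 + if i = j then 1 else 0) : h = simplexForm n := by
  have hdec : ∀ w : EuclideanSpace ℝ (Fin n),
      w = ∑ i, w i • EuclideanSpace.single i (1 : ℝ) := by
    intro w
    ext k
    simp [Pi.single_apply]
  ext v w
  obtain ⟨v, rfl⟩ := (bijective_of_simplexForm_eq hL).2 v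
  obtain ⟨w, rfl⟩ := (bijective_of_simplexForm_eq hL).2 w
  rw [hL, hdec v, hdec w]
  simp only [map_sum, map_smul, sum_apply, smul_apply, hh,
    simplexForm_single]

end SimplexForm

/-! ### Transition maps between charts of stars -/

namespace Star

variable {V : Type*} {n : ℕ} {Γ : Set (Set V)}

/-- On the common part of the domains, the charts of `S` and `T` differ by an affine map that
preserves `simplexForm`. -/
def Compatible (S T : Star n Γ) : Prop :=
  ∃ (L : EuclideanSpace ℝ (Fin n) →L[ℝ] EuclideanSpace ℝ (Fin n)) (c : EuclideanSpace ℝ (Fin n)),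
    (∀ u v, simplexForm n (L u) (L v) = simplexForm n u v) ∧
    ∀ x ∈ openRealization n Γ, (∀ i, 0 < x (S.p i)) → (∀ i, 0 < x (T.p i)) →
      T.coords x = L (S.coords x) + c

/-- The star with the two apexes interchanged. -/
def flip (S : Star n Γ) : Star n Γ where
  p := S.p
  q := S.q'
  q' := S.q
  pos := S.pos
  inj := S.inj
  hq := S.hq'
  hq' := S.hq
  hne := S.hne.symm
  crease := S.crease
  face := S.face'
  face' := S.face
  sub γ hγ h := (S.sub γ hγ h).symm

/-- On either facet the weights at the crease and the two apexes sum to 1, so the weight at `q` is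
linear in the other weights and exchanging the apexes is the reflection `mirror`. This allows either
apex to be taken as `q` in what follows. -/
theorem coords_flip (S : Star n Γ) {x : V → ℝ} (hx : x ∈ openRealization n Γ)
    (hp : ∀ i, 0 < x (S.p i)) :
    S.flip.coords x = mirrorDir n (S.coords x) + WithLp.toLp 2 fun _ => 2 / (n : ℝ) := by
  ext i
  have h : S.flip.coords x i = mirror (S.coords x) i := by
    rw [S.mirror_coords]
    rcases (S.cases_of_pos hx hp).2 with ⟨h1, h2, h3⟩ | ⟨h1, h2, h3⟩
    · rw [show 1 - ∑ i, x (S.p i) - x S.q' = x S.q by linarith]; rfl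
    · rw [show 1 - ∑ i, x (S.p i) - x S.q' = x S.q by linarith]; rfl
  rw [h, mirror_eq, PiLp.add_apply, mirrorDir_apply]
  ring

theorem Compatible.of_flip_left {S T : Star n Γ} (h : S.flip.Compatible T) : S.Compatible T := by
  obtain ⟨L, c, hL, hc⟩ := h
  refine ⟨L.comp (mirrorDir n), L (WithLp.toLp 2 fun _ => 2 / (n : ℝ)) + c, fun u v => ?_,
    fun x hx hS hT => ?_⟩
  · rw [ContinuousLinearMap.comp_apply, ContinuousLinearMap.comp_apply, hL,
      simplexForm_mirrorDir S.pos]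
  · rw [hc x hx hS hT, S.coords_flip hx hS, map_add, ContinuousLinearMap.comp_apply, add_assoc]

theorem Compatible.of_flip_right {S T : Star n Γ} (h : S.Compatible T.flip) : S.Compatible T := by
  obtain ⟨L, c, hL, hc⟩ := h
  refine ⟨(mirrorDir n).comp L, mirrorDir n c + WithLp.toLp 2 fun _ => 2 / (n : ℝ), fun u v => ?_,
    fun x hx hS hT => ?_⟩
  · rw [ContinuousLinearMap.comp_apply, ContinuousLinearMap.comp_apply,
      simplexForm_mirrorDir S.pos, hL]
  · have h1 := T.flip.coords_flip hx hT
    rw [hc x hx hS hT, map_add, add_assoc] at h1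
    exact h1

/-- The vertices of the facet of `S` with apex `q`. -/
def vertex (S : Star n Γ) (o : Option (Fin n)) : V := o.elim S.q S.p

theorem vertex_injective (S : Star n Γ) : Function.Injective S.vertex := by
  rintro (_ | i) (_ | j) h
  · rfl
  · exact absurd h.symm (S.hq j)
  · exact absurd h (S.hq i)
  · exact congrArg some (S.inj h)

/-- The pseudomanifold property: `sub` leaves only two possible apexes over a given crease. -/
theorem eq_q_or_eq_q' (S : Star n Γ) {r : V} (hr : r ∉ Set.range S.p)
    (hΓ : insert r (Set.range S.p) ∈ Γ) : r = S.q ∨ r = S.q' :=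
  (S.sub _ hΓ (Set.subset_insert _ _)).imp
    (fun h => (h (Set.mem_insert _ _)).resolve_right hr)
    (fun h => (h (Set.mem_insert _ _)).resolve_right hr)

theorem eq_q_or_eq_q'_of_pos (S : Star n Γ) {x : V → ℝ} (hx : x ∈ openRealization n Γ)
    (hp : ∀ i, 0 < x (S.p i)) {r : V} (hr : r ∉ Set.range S.p) (hxr : 0 < x r) :
    r = S.q ∨ r = S.q' := by
  by_contra! h
  exact hxr.ne' ((S.cases_of_pos hx hp).1 r (fun i hi => hr ⟨i, hi.symm⟩) h.1 h.2)

theorem apply_q' (S : Star n Γ) {x : V → ℝ} (hx : x ∈ openRealization n Γ)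
    (hp : ∀ i, 0 < x (S.p i)) (hxq : 0 < x S.q) : x S.q' = 0 ∧ x S.q = 1 - ∑ i, x (S.p i) := by
  rcases (S.cases_of_pos hx hp).2 with ⟨h1, h2, h3⟩ | ⟨h1, h2, h3⟩
  · exact ⟨h1, by linarith⟩
  · exact absurd h1 hxq.ne'

/-- The second apex is forced to agree too, so the charts differ by a reordering of the crease, and
the shift `2 / n * x q'` is the same in every coordinate. -/
theorem compatible_of_range_eq {S T : Star n Γ} (h : Set.range S.p = Set.range T.p)
    (hq : T.q = S.q) : S.Compatible T := by
  have hq' : T.q' = S.q' := by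
    refine (S.eq_q_or_eq_q' ?_ (h ▸ T.face')).resolve_left (hq ▸ T.hne.symm)
    rw [h]
    rintro ⟨i, hi⟩
    exact T.hq' i hi
  have hex : ∀ i, ∃ j, S.p j = T.p i := fun i => by
    have : T.p i ∈ Set.range S.p := h ▸ ⟨i, rfl⟩
    exact this
  choose f hf using hex
  have hfinj : Function.Injective f := fun i j hij => T.inj (by rw [← hf i, ← hf j, hij])
  let π : Equiv.Perm (Fin n) := Equiv.ofBijective f (Finite.injective_iff_bijective.1 hfinj)
  -- `optionCongr` fixes `none`, that is, the common apex.
  refine ⟨permDir π.optionCongr, 0, simplexForm_permDir _, fun x _ _ _ => ?_⟩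
  ext i
  have hπ : S.p (π i) = T.p i := hf i
  simp [permDir_apply, baryDir, coords, hπ, hq']

/-- Each first apex is a crease vertex of the other star, hence has positive weight throughout the
overlap. So the overlap lies in one open facet, both second apexes have weight zero there, and both
charts read off barycentric coordinates of that facet. -/
theorem compatible_of_q_mem {S T : Star n Γ} (hS : S.q ∈ Set.range T.p)
    (hT : T.q ∈ Set.range S.p) : S.Compatible T := by
  by_cases hex : ∃ x ∈ openRealization n Γ, (∀ i, 0 < x (S.p i)) ∧ ∀ i, 0 < x (T.p i)
  swap
  · exact ⟨ContinuousLinearMap.id ℝ _, 0, fun _ _ => rfl,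
      fun x hx h1 h2 => absurd ⟨x, hx, h1, h2⟩ hex⟩
  have hSpos : ∀ x : V → ℝ, (∀ i, 0 < x (T.p i)) → 0 < x S.q := by
    obtain ⟨j, hj⟩ := hS
    exact fun x hx => hj ▸ hx j
  have hTpos : ∀ x : V → ℝ, (∀ i, 0 < x (S.p i)) → 0 < x T.q := by
    obtain ⟨j, hj⟩ := hT
    exact fun x hx => hj ▸ hx j
  have hvert : ∀ o, ∃ o', S.vertex o' = T.vertex o := by
    obtain ⟨x, hx, h1, h2⟩ := hex
    rintro (_ | i)
    · obtain ⟨j, hj⟩ := hT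
      exact ⟨some j, hj⟩
    · by_cases hi : T.p i ∈ Set.range S.p
      · obtain ⟨j, hj⟩ := hi
        exact ⟨some j, hj⟩
      · rcases S.eq_q_or_eq_q'_of_pos hx h1 hi (h2 i) with h | h
        · exact ⟨none, h.symm⟩
        -- A crease vertex of `T` cannot be `S.q'`, since its weight is positive and that of `S.q'`
        -- is zero.
        · have := h2 i
          rw [h, (S.apply_q' hx h1 (hSpos x h2)).1] at this
          exact absurd this (lt_irrefl _)
  choose f hf using hvert
  have hfinj : Function.Injective f := fun i j hij =>
    T.vertex_injective (by rw [← hf i, ← hf j, hij])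
  let π : Equiv.Perm (Option (Fin n)) :=
    Equiv.ofBijective f (Finite.injective_iff_bijective.1 hfinj)
  -- The constant 1 occurs exactly where `T.p i` is the apex `S.q`, whose weight is `1 - ∑ x (S.p
  -- i)`; `permDir` supplies only the linear part of this.
  refine ⟨permDir π, WithLp.toLp 2 fun i => (π (some i)).elim 1 fun _ => 0,
    simplexForm_permDir π, fun x hx h1 h2 => ?_⟩
  obtain ⟨hq0, hq1⟩ := S.apply_q' hx h1 (hSpos x h2)
  obtain ⟨hr0, -⟩ := T.apply_q' hx h2 (hTpos x h1)
  ext i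
  have hπ : S.vertex (π (some i)) = T.p i := hf (some i)
  rw [PiLp.add_apply, permDir_apply]
  rcases h : π (some i) with _ | j
  · rw [h] at hπ
    have hπ' : S.q = T.p i := hπ
    simp only [baryDir, coords, hr0, hq0, ← hπ', h, Option.elim_none, mul_zero, add_zero, hq1]
    ring
  · rw [h] at hπ
    have hπ' : S.p j = T.p i := hπ
    simp [baryDir, coords, hr0, hq0, ← hπ', h]

theorem not_range_subset {S T : Star n Γ} (h : Set.range S.p ≠ Set.range T.p) :
    ∃ i, T.p i ∉ Set.range S.p := by
  by_contra! hsub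
  refine h (Set.eq_of_subset_of_ncard_le (Set.range_subset_iff.2 hsub) ?_ (Set.toFinite _)).symm
  rw [← Set.image_univ, ← Set.image_univ, Set.ncard_image_of_injective _ S.inj,
    Set.ncard_image_of_injective _ T.inj]

/-- With distinct creases, each has a vertex outside the other. At a common point that vertex has
positive weight, so it is an apex of the other star. Flipping where needed makes it the first apex.
-/
theorem compatible (S T : Star n Γ) : S.Compatible T := by
  by_cases h : Set.range S.p = Set.range T.p
  · have hq : T.q ∉ Set.range S.p := by
      rw [h]
      rintro ⟨i, hi⟩
      exact T.hq i hi
    rcases S.eq_q_or_eq_q' hq (h ▸ T.face) with hq | hq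
    · exact compatible_of_range_eq h hq
    · exact (compatible_of_range_eq (S := S.flip) h hq).of_flip_left
  · by_cases hex : ∃ x ∈ openRealization n Γ, (∀ i, 0 < x (S.p i)) ∧ ∀ i, 0 < x (T.p i)
    swap
    · exact ⟨ContinuousLinearMap.id ℝ _, 0, fun _ _ => rfl,
        fun x hx h1 h2 => absurd ⟨x, hx, h1, h2⟩ hex⟩
    obtain ⟨x, hx, h1, h2⟩ := hex
    obtain ⟨i, hi⟩ := not_range_subset h
    obtain ⟨j, hj⟩ := not_range_subset (Ne.symm h)
    rcases S.eq_q_or_eq_q'_of_pos hx h1 hi (h2 i) with hS | hS <;>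
      rcases T.eq_q_or_eq_q'_of_pos hx h2 hj (h1 j) with hT | hT
    · exact compatible_of_q_mem ⟨i, hS⟩ ⟨j, hT⟩
    · exact (compatible_of_q_mem (T := T.flip) ⟨i, hS⟩ ⟨j, hT⟩).of_flip_right
    · exact (compatible_of_q_mem (S := S.flip) ⟨i, hS⟩ ⟨j, hT⟩).of_flip_left
    · exact (compatible_of_q_mem (S := S.flip) (T := T.flip) ⟨i, hS⟩
        ⟨j, hT⟩).of_flip_right.of_flip_left

end Star

end Serenation

/-! ### Second countability of the components -/

namespace Serenation

/-- A countable set is contained in a countable set closed under a countably-valued operation on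
finite subsets. -/
theorem exists_countable_closed {V : Type*} (f : Set V → Set V) (hf : ∀ P, (f P).Countable)
    {W₀ : Set V} (hW₀ : W₀.Countable) :
    ∃ W : Set V, W₀ ⊆ W ∧ W.Countable ∧ ∀ P : Set V, P.Finite → P ⊆ W → f P ⊆ W := by
  let step : Set V → Set V := fun W => W ∪ ⋃ P ∈ {P : Set V | P.Finite ∧ P ⊆ W}, f P
  let W : ℕ → Set V := fun k => step^[k] W₀
  have hsucc : ∀ k, W (k + 1) = step (W k) := fun k => Function.iterate_succ_apply' step k W₀
  have hcount : ∀ k, (W k).Countable := by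
    intro k
    induction k with
    | zero => exact hW₀
    | succ k ih =>
      rw [hsucc]
      exact ih.union ((Set.countable_ofPred_finite_subset ih).biUnion fun P _ => hf P)
  have hmono : Monotone W := monotone_nat_of_le_succ fun k => by
    rw [hsucc]
    exact Set.subset_union_left
  refine ⟨⋃ k, W k, Set.subset_iUnion W 0, Set.countable_iUnion hcount, fun P hP hPW => ?_⟩
  -- A finite subset of the increasing union already lies in some stage `W k`, so its image was
  -- adjoined at stage `k + 1`.
  obtain ⟨k, hk⟩ := (hmono.directed_le).exists_mem_subset_of_finset_subset_biUnion
    (s := hP.toFinset) (by simpa using hPW)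
  refine Set.Subset.trans (fun r hr => ?_) (Set.subset_iUnion W (k + 1))
  rw [hsucc]
  exact Or.inr (Set.mem_biUnion (x := P) ⟨hP, by simpa using hk⟩ hr)

namespace Star

variable {V : Type*} {n : ℕ} {Γ : Set (Set V)}

/-- All stars with crease `P` share the same two apexes, so the set has at most two elements. -/
theorem countable_apexes (P : Set V) :
    {r | ∃ S : Star n Γ, Set.range S.p = P ∧ (r = S.q ∨ r = S.q')}.Countable := by
  by_cases h : ∃ S : Star n Γ, Set.range S.p = P
  · obtain ⟨S, rfl⟩ := h
    refine (Set.toFinite {S.q, S.q'}).countable.mono ?_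
    rintro r ⟨T, hT, rfl | rfl⟩
    · exact S.eq_q_or_eq_q' (by rw [← hT]; rintro ⟨i, hi⟩; exact T.hq i hi) (hT ▸ T.face)
    · exact S.eq_q_or_eq_q' (by rw [← hT]; rintro ⟨i, hi⟩; exact T.hq' i hi) (hT ▸ T.face')
  · refine Set.countable_empty.mono ?_
    rintro r ⟨T, hT, -⟩
    exact h ⟨T, hT⟩

theorem _root_.Serenation.countable_support_of_mem_openRealization (hn : 1 ≤ n) {x : V → ℝ}
    (hx : x ∈ openRealization n Γ) : {s | x s ≠ 0}.Countable := by
  obtain ⟨γ, hγ, hxγ⟩ := Set.mem_iUnion₂.1 hx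
  obtain ⟨-, hcard⟩ : γ ∈ Γ ∧ (γ.ncard = n ∨ γ.ncard = n + 1) := hγ
  have hfin : γ.Finite := Set.finite_of_ncard_ne_zero (by omega)
  obtain ⟨t, rfl⟩ := hfin.exists_finset_coe
  have htne : t.Nonempty := by
    rw [Set.ncard_coe_finset] at hcard
    exact Finset.card_pos.1 (by omega)
  refine t.countable_toSet.mono fun s hs => ?_
  by_contra h
  exact hs (((mem_ocvx_vertexPt_iff t htne x).1 hxγ).2.1 s h)

/-- If the open stars cover the realization, its connected components are second countable. -/
theorem secondCountableTopology_connectedComponent (hn : 1 ≤ n)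
    (hcover : ∀ x : openRealization n Γ, ∃ S : Star n Γ, ∀ i, 0 < (x : V → ℝ) (S.p i))
    (x : openRealization n Γ) : SecondCountableTopology (connectedComponent x) := by
  obtain ⟨W, hW₀, hWc, hW⟩ := exists_countable_closed
    (fun P => {r | ∃ S : Star n Γ, Set.range S.p = P ∧ (r = S.q ∨ r = S.q')}) countable_apexes
    (countable_support_of_mem_openRealization hn x.2)
  have hcont : ∀ s : V, Continuous fun y : openRealization n Γ => (y : V → ℝ) s := fun s =>
    (continuous_apply s).comp continuous_subtype_val
  -- `O` is clopen and so contains the component of `x`. It is open because a star around a point of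
  -- `O` has its crease in `W`, hence also its apexes, and points of the star have no other nonzero
  -- weights.
  let O : Set (openRealization n Γ) := {y | ∀ s ∉ W, (y : V → ℝ) s = 0}
  have hclosed : IsClosed O := by
    have : O = ⋂ s ∈ Wᶜ, {y : openRealization n Γ | (y : V → ℝ) s = 0} := by
      ext; simp [O]
    rw [this]
    exact isClosed_biInter fun s _ => isClosed_eq (hcont s) continuous_const
  have hopen : IsOpen O := by
    refine isOpen_iff_mem_nhds.2 fun y hy => ?_
    obtain ⟨S, hS⟩ := hcover y
    have hSW : Set.range S.p ⊆ W := by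
      rintro _ ⟨i, rfl⟩
      by_contra h
      exact (hS i).ne' (hy _ h)
    have hapex := hW _ (Set.finite_range S.p) hSW
    refine Filter.mem_of_superset (S.chart.open_source.mem_nhds hS) fun z hz s hs => ?_
    refine (S.cases_of_pos z.2 hz).1 s ?_ ?_ ?_
    · rintro i rfl
      exact hs (hSW ⟨i, rfl⟩)
    · rintro rfl
      exact hs (hapex ⟨S, rfl, Or.inl rfl⟩)
    · rintro rfl
      exact hs (hapex ⟨S, rfl, Or.inr rfl⟩)
  have hsub : connectedComponent x ⊆ O :=
    IsClopen.connectedComponent_subset ⟨hclosed, hopen⟩ fun s hs => by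
      by_contra h
      exact hs (hW₀ h)
  have : Countable W := hWc
  let ρ : connectedComponent x → W → ℝ := fun y s => (y.1 : V → ℝ) s
  have hρ : Topology.IsInducing ρ := by
    -- Extension by zero recovers the point of `ℝ^V` from its coordinates in `W`.
    refine Topology.IsInducing.of_comp (g := fun (f : W → ℝ) (s : V) => by
      classical exact if h : s ∈ W then f ⟨s, h⟩ else 0) ?_ ?_ ?_
    · exact continuous_pi fun s => (hcont s).comp continuous_subtype_val
    · refine continuous_pi fun s => ?_
      by_cases h : s ∈ W
      · simpa [h] using continuous_apply (⟨s, h⟩ : W)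
      · simpa [h] using continuous_const
    · have : ((fun (f : W → ℝ) (s : V) => by
          classical exact if h : s ∈ W then f ⟨s, h⟩ else 0) ∘ ρ) =
          fun y : connectedComponent x => (y.1 : V → ℝ) := by
        funext y s
        by_cases h : s ∈ W
        · simp [h, ρ]
        · simp [h, hsub y.2 s h]
      rw [this]
      exact Topology.IsInducing.subtypeVal.comp Topology.IsInducing.subtypeVal
  exact hρ.secondCountableTopology

end Star

end Serenation

/-! ### Smooth structure and smoothness of the form -/

namespace Serenation

namespace AltQuasigroup

variable {n : ℕ} {A : Type*} {Q : AltQuasigroup n A}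

theorem exists_star_of_mem_atlas {e : OpenPartialHomeomorph Q.OSer (EuclideanSpace ℝ (Fin n))}
    (he : e ∈ atlas (EuclideanSpace ℝ (Fin n)) Q.OSer) :
    ∃ S : Star n Q.simplicization, e = S.chart := by
  obtain ⟨a, rfl | rfl⟩ := Set.mem_iUnion.1 he
  · exact ⟨inputStar a, rfl⟩
  · exact ⟨outputStar a, rfl⟩

/-- The transition maps are affine and preserve `simplexForm`. -/
theorem exists_transition {e e' : OpenPartialHomeomorph Q.OSer (EuclideanSpace ℝ (Fin n))}
    (he : e ∈ atlas (EuclideanSpace ℝ (Fin n)) Q.OSer)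
    (he' : e' ∈ atlas (EuclideanSpace ℝ (Fin n)) Q.OSer) :
    ∃ (L : EuclideanSpace ℝ (Fin n) →L[ℝ] EuclideanSpace ℝ (Fin n)) (c : EuclideanSpace ℝ (Fin n)),
      (∀ u v, simplexForm n (L u) (L v) = simplexForm n u v) ∧
      Set.EqOn (e' ∘ e.symm) (fun u => L u + c) (e.symm ≫ₕ e').source := by
  obtain ⟨S, rfl⟩ := exists_star_of_mem_atlas he
  obtain ⟨T, rfl⟩ := exists_star_of_mem_atlas he'
  obtain ⟨L, c, hL, hc⟩ := S.compatible T
  refine ⟨L, c, hL, fun u hu => ?_⟩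
  rw [OpenPartialHomeomorph.trans_source] at hu
  have h1 : S.chart.symm u ∈ S.chart.source := S.chart.map_target hu.1
  have h2 := hc _ (S.chart.symm u).2 h1 hu.2
  have h3 : S.coords (S.chart.symm u : Q.OSer) = u := S.chart.right_inv hu.1
  rw [h3] at h2
  exact h2

theorem isManifold_OSer : IsManifold 𝓘(ℝ, EuclideanSpace ℝ (Fin n)) ∞ Q.OSer := by
  refine isManifold_of_contDiffOn _ _ _ fun e e' he he' => ?_
  obtain ⟨L, c, -, hL⟩ := exists_transition he he'
  have h : ContDiff ℝ ∞ fun u => L u + c := L.contDiff.add contDiff_const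
  refine h.contDiffOn.congr fun u hu => hL ?_
  simpa using hu

/-- The derivative of the inverse of a chart, read in the preferred chart. -/
theorem exists_hasMFDerivAt_symm {e : OpenPartialHomeomorph Q.OSer (EuclideanSpace ℝ (Fin n))}
    (he : e ∈ atlas (EuclideanSpace ℝ (Fin n)) Q.OSer) {u : EuclideanSpace ℝ (Fin n)}
    (hu : u ∈ e.target) :
    ∃ L : EuclideanSpace ℝ (Fin n) →L[ℝ] EuclideanSpace ℝ (Fin n),
      (∀ u v, simplexForm n (L u) (L v) = simplexForm n u v) ∧
      HasMFDerivAt 𝓘(ℝ, EuclideanSpace ℝ (Fin n)) 𝓘(ℝ, EuclideanSpace ℝ (Fin n)) e.symm u L := by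
  obtain ⟨L, c, hL, hc⟩ := exists_transition he (chart_mem_atlas _ (e.symm u))
  refine ⟨L, hL, e.symm.continuousAt hu, ?_⟩
  have hmem : (e.symm ≫ₕ chartAt (EuclideanSpace ℝ (Fin n)) (e.symm u)).source ∈ nhds u := by
    refine (OpenPartialHomeomorph.open_source _).mem_nhds ?_
    rw [OpenPartialHomeomorph.trans_source]
    exact ⟨hu, mem_chart_source _ _⟩
  have h1 : HasFDerivAt (fun u => L u + c) L u := L.hasFDerivAt.add_const c
  have h2 := h1.congr_of_eventuallyEq (Filter.eventuallyEq_of_mem hmem hc)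
  simpa [writtenInExtChartAt, Function.comp_def] using! h2.hasFDerivWithinAt

/-- The coordinate change is the derivative of an affine transition map, hence its linear part.
Consequently the same constant form may be used on every fibre, whichever preferred chart the fibre
is read in. -/
theorem tangentCoordChange_preserves [IsManifold 𝓘(ℝ, EuclideanSpace ℝ (Fin n)) 1 Q.OSer]
    (x y : Q.OSer) {z : Q.OSer}
    (hx : z ∈ (chartAt (EuclideanSpace ℝ (Fin n)) x).source)
    (hy : z ∈ (chartAt (EuclideanSpace ℝ (Fin n)) y).source) (v w : EuclideanSpace ℝ (Fin n)) :
    simplexForm n (tangentCoordChange 𝓘(ℝ, EuclideanSpace ℝ (Fin n)) x y z v)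
      (tangentCoordChange 𝓘(ℝ, EuclideanSpace ℝ (Fin n)) x y z w) = simplexForm n v w := by
  obtain ⟨L, c, hL, hc⟩ := exists_transition (chart_mem_atlas (EuclideanSpace ℝ (Fin n)) x)
    (chart_mem_atlas (EuclideanSpace ℝ (Fin n)) y)
  have hmem : ((chartAt (EuclideanSpace ℝ (Fin n)) x).symm ≫ₕ
      chartAt (EuclideanSpace ℝ (Fin n)) y).source ∈
        nhds (chartAt (EuclideanSpace ℝ (Fin n)) x z) := by
    refine (OpenPartialHomeomorph.open_source _).mem_nhds ?_
    rw [OpenPartialHomeomorph.trans_source]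
    refine ⟨(chartAt (EuclideanSpace ℝ (Fin n)) x).map_source hx, ?_⟩
    rwa [Set.mem_preimage, OpenPartialHomeomorph.left_inv _ hx]
  have h1 : HasFDerivAt (fun u => L u + c) L (chartAt (EuclideanSpace ℝ (Fin n)) x z) :=
    L.hasFDerivAt.add_const c
  have h2 := (h1.congr_of_eventuallyEq (Filter.eventuallyEq_of_mem hmem hc)).fderiv
  have h3 : tangentCoordChange 𝓘(ℝ, EuclideanSpace ℝ (Fin n)) x y z = L := by
    rw [tangentCoordChange_def]
    simpa [Function.comp_def] using h2
  rw [h3, hL]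

variable (Q) in
/-- The field of bilinear forms which is `simplexForm` in every chart. -/
noncomputable def stdInner : BilinField n Q.OSer := fun _ => simplexForm n

/-- In the trivialization at `x₀` the section is locally the constant `simplexForm n`. -/
theorem contMDiff_stdInner [IsManifold 𝓘(ℝ, EuclideanSpace ℝ (Fin n)) ∞ Q.OSer] :
    ContMDiff 𝓘(ℝ, EuclideanSpace ℝ (Fin n)) (𝓘(ℝ, EuclideanSpace ℝ (Fin n)).prod
      𝓘(ℝ, EuclideanSpace ℝ (Fin n) →L[ℝ] EuclideanSpace ℝ (Fin n) →L[ℝ] ℝ)) ∞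
      (fun x : Q.OSer => Bundle.TotalSpace.mk'
        (EuclideanSpace ℝ (Fin n) →L[ℝ] EuclideanSpace ℝ (Fin n) →L[ℝ] ℝ)
        (E := fun x : Q.OSer => TangentSpace 𝓘(ℝ, EuclideanSpace ℝ (Fin n)) x →L[ℝ]
          TangentSpace 𝓘(ℝ, EuclideanSpace ℝ (Fin n)) x →L[ℝ] ℝ) x (stdInner Q x)) := by
  intro x₀
  rw [contMDiffAt_hom_bundle]
  refine ⟨contMDiffAt_id, ?_⟩
  refine (contMDiffAt_const (c := simplexForm n)).congr_of_eventuallyEq ?_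
  filter_upwards [(chartAt (EuclideanSpace ℝ (Fin n)) x₀).open_source.mem_nhds
    (mem_chart_source _ x₀)] with x hx
  ext v w
  simp [ContinuousLinearMap.inCoordinates, hom_trivializationAt_apply, hx]
  have hcc := TangentBundle.symmL_trivializationAt_eq_core (𝕜 := ℝ)
    (I := 𝓘(ℝ, EuclideanSpace ℝ (Fin n))) hx
  rw [hcc]
  exact tangentCoordChange_preserves x₀ x hx (mem_chart_source _ x) v w

end AltQuasigroup

end Serenation

namespace Serenation

/-! ### Flatness, ambient tangent vectors and the defining rules -/

section Flat

variable {n : ℕ}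

theorem riemannCurvature_eq_zero {G : EuclideanSpace ℝ (Fin n) → Matrix (Fin n) (Fin n) ℝ}
    {U : Set (EuclideanSpace ℝ (Fin n))} (hU : IsOpen U) {C : Matrix (Fin n) (Fin n) ℝ}
    (hG : ∀ u ∈ U, G u = C) (l k i j : Fin n) {u : EuclideanSpace ℝ (Fin n)} (hu : u ∈ U) :
    riemannCurvature G l k i j u = 0 := by
  have hd : ∀ (φ : EuclideanSpace ℝ (Fin n) → ℝ) (c : ℝ), (∀ w ∈ U, φ w = c) →
      ∀ (m : Fin n), ∀ w ∈ U, partialDeriv m φ w = 0 := by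
    intro φ c hφ m w hw
    have h : φ =ᶠ[nhds w] fun _ => c := Filter.eventuallyEq_of_mem (hU.mem_nhds hw) hφ
    rw [partialDeriv, h.fderiv_eq]
    simp
  -- Vanishing is needed on all of `U`, not only at `u`, because the symbols are differentiated once
  -- more.
  have hch : ∀ k i j, ∀ w ∈ U, christoffel G k i j w = 0 := by
    intro k i j w hw
    have h : ∀ m a b : Fin n, partialDeriv m (fun w => G w a b) w = 0 := fun m a b =>
      hd _ (C a b) (fun w hw => by rw [hG w hw]) m w hw
    simp [christoffel, h]
  rw [riemannCurvature, hd _ 0 (hch l j k) i u hu, hd _ 0 (hch l i k) j u hu]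
  simp [hch _ _ _ u hu]

end Flat

namespace Star

variable {V : Type*} {n : ℕ} {Γ : Set (Set V)} (S : Star n Γ)

theorem coe_chart_symm {u : EuclideanSpace ℝ (Fin n)} (hu : u ∈ bipyr n) :
    (S.chart.symm u : V → ℝ) = bipyrMap S.p S.q S.q' u := by
  have : S.chart.symm u = ⟨bipyrMap S.p S.q S.q' u, S.map_mem hu⟩ := dif_pos hu
  rw [this]

/-- On the open facet with apex `q`, the inverse chart is affine. -/
theorem hasFDerivAt_bipyrMap {u : EuclideanSpace ℝ (Fin n)} (hu : ∑ i, u i < 1) (s : V) :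
    HasFDerivAt (fun w => bipyrMap S.p S.q S.q' w s)
      (∑ i, (vertexPt (S.p i) s - vertexPt S.q s) • EuclideanSpace.proj (𝕜 := ℝ) i :
        EuclideanSpace ℝ (Fin n) →L[ℝ] ℝ) u := by
  set D : EuclideanSpace ℝ (Fin n) →L[ℝ] ℝ :=
    ∑ i, (vertexPt (S.p i) s - vertexPt S.q s) • EuclideanSpace.proj (𝕜 := ℝ) i with hD
  have h : HasFDerivAt (fun w => D w + vertexPt S.q s) D u := D.hasFDerivAt.add_const _
  refine h.congr_of_eventuallyEq ?_
  have hopen : IsOpen {w : EuclideanSpace ℝ (Fin n) | ∑ i, w i < 1} :=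
    isOpen_lt (by fun_prop) continuous_const
  filter_upwards [hopen.mem_nhds hu] with w hw
  have hw : ∑ i, w i < 1 := hw
  rw [bipyrMap, if_pos hw.le]
  simp only [hD, Pi.add_apply, Finset.sum_apply, Pi.smul_apply, smul_eq_mul, sum_apply, smul_apply,
    EuclideanSpace.coe_proj, sub_mul, Finset.sum_sub_distrib, ← Finset.mul_sum]
  rw [Finset.sum_congr rfl fun i _ => mul_comm (w i) _]
  ring

end Star

/-- Used to recover the open face containing a point from its support. The condition on `ncard` says
that `γ` is finite and nonempty. -/
theorem pos_iff_of_mem_ocvx {V : Type*} {γ : Set V} (hγ : γ.ncard ≠ 0) {x : V → ℝ}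
    (hx : x ∈ ocvx (vertexPt '' γ)) (s : V) : 0 < x s ↔ s ∈ γ := by
  obtain ⟨t, rfl⟩ := (Set.finite_of_ncard_ne_zero hγ).exists_finset_coe
  have htne : t.Nonempty := by
    rw [Set.ncard_coe_finset] at hγ
    exact Finset.card_ne_zero.1 hγ
  obtain ⟨h1, h2, -⟩ := (mem_ocvx_vertexPt_iff t htne x).1 hx
  exact ⟨fun h => by_contra fun hs => h.ne' (h2 s hs), h1 s⟩

namespace AltQuasigroup

variable {n : ℕ} {A : Type*} {Q : AltQuasigroup n A}

section Metric

variable [IsManifold 𝓘(ℝ, EuclideanSpace ℝ (Fin n)) ∞ Q.OSer]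

variable (Q) in
/-- The standard metric. -/
noncomputable def stdMetric : Bundle.ContMDiffRiemannianMetric 𝓘(ℝ, EuclideanSpace ℝ (Fin n)) ∞
    (EuclideanSpace ℝ (Fin n))
    (fun x : Q.OSer => TangentSpace 𝓘(ℝ, EuclideanSpace ℝ (Fin n)) x) where
  inner := stdInner Q
  symm _ v w := simplexForm_symm (n := n) v w
  pos _ v hv := simplexForm_pos (n := n) (u := v) hv
  isVonNBounded _ := by
    have h : Bornology.IsVonNBounded ℝ (Metric.ball (0 : EuclideanSpace ℝ (Fin n)) 1) :=
      NormedSpace.isVonNBounded_ball ℝ _ 1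
    have hsub : {v : EuclideanSpace ℝ (Fin n) | simplexForm n v v < 1} ⊆ Metric.ball 0 1 := by
      intro v (hv : simplexForm n v v < 1)
      have := norm_sq_le_simplexForm v
      rw [mem_ball_zero_iff]
      nlinarith [norm_nonneg v]
    exact h.subset hsub
  contMDiff := contMDiff_stdInner

end Metric

theorem stdInner_coordVec {e : OpenPartialHomeomorph Q.OSer (EuclideanSpace ℝ (Fin n))}
    (he : e ∈ atlas (EuclideanSpace ℝ (Fin n)) Q.OSer) {u : EuclideanSpace ℝ (Fin n)}
    (hu : u ∈ e.target) (i j : Fin n) :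
    stdInner Q (e.symm u) (coordVec e u i) (coordVec e u j) = 1 + if i = j then 1 else 0 := by
  obtain ⟨L, hL, hd⟩ := exists_hasMFDerivAt_symm he hu
  rw [coordVec, coordVec, hd.mfderiv]
  exact (hL _ _).trans (simplexForm_single i j)

theorem metricMatrix_stdInner {e : OpenPartialHomeomorph Q.OSer (EuclideanSpace ℝ (Fin n))}
    (he : e ∈ atlas (EuclideanSpace ℝ (Fin n)) Q.OSer) {u : EuclideanSpace ℝ (Fin n)}
    (hu : u ∈ e.target) :
    metricMatrix (stdInner Q) e u = Matrix.of (fun _ _ => (1 : ℝ)) + 1 := by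
  ext i j
  rw [metricMatrix, Matrix.of_apply, stdInner_coordVec he hu, Matrix.add_apply, Matrix.of_apply,
    Matrix.one_apply]

theorem isFlat_stdInner : IsFlat (stdInner Q) := fun e he _ hu l k i j =>
  riemannCurvature_eq_zero e.open_target (fun _ hw => metricMatrix_stdInner he hw) l k i j hu

/-- The coordinate vectors of a single chart form a basis of the tangent space, so their products
determine the form. -/
theorem eq_stdInner_apply {e : OpenPartialHomeomorph Q.OSer (EuclideanSpace ℝ (Fin n))}
    (he : e ∈ atlas (EuclideanSpace ℝ (Fin n)) Q.OSer) {u : EuclideanSpace ℝ (Fin n)}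
    (hu : u ∈ e.target) {h : BilinField n Q.OSer}
    (hh : ∀ i j, h (e.symm u) (coordVec e u i) (coordVec e u j) = 1 + if i = j then 1 else 0) :
    h (e.symm u) = stdInner Q (e.symm u) := by
  obtain ⟨L, hL, hd⟩ := exists_hasMFDerivAt_symm he hu
  simp only [coordVec, hd.mfderiv] at hh
  exact eq_simplexForm hL hh

theorem inputChart_mem_atlas (a : Q.NCT) :
    inputChart a ∈ atlas (EuclideanSpace ℝ (Fin n)) Q.OSer :=
  Set.mem_iUnion.2 ⟨a, Or.inl rfl⟩

theorem outputChart_mem_atlas (a : Q.NCT) :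
    outputChart a ∈ atlas (EuclideanSpace ℝ (Fin n)) Q.OSer :=
  Set.mem_iUnion.2 ⟨a, Or.inr rfl⟩

theorem facet_ncard (a : Q.NCT) : (Q.facet a.1).ncard = n + 1 := by
  have hinj : Function.Injective fun i => (Sum.inl (a.1 i) : A ⊕ A) := (inputStar a).inj
  rw [facet, Set.ncard_insert_of_notMem (by simp) (Set.finite_range _), ← Set.image_univ,
    Set.ncard_image_of_injective _ hinj]
  simp

/-- The open facet lies in the half `∑ u < 1` of the bipyramid because the weight at the apex `f a`,
namely `max (1 - ∑ u) 0`, is positive there. -/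
theorem exists_inputChart_symm (a : Q.NCT) {x : Q.OSer}
    (hx : (x : A ⊕ A → ℝ) ∈ ocvx (vertexPt '' Q.facet a.1)) :
    ∃ u ∈ bipyr n, ∑ i, u i < 1 ∧ (inputChart a).symm u = x := by
  have hpos := pos_iff_of_mem_ocvx (by rw [facet_ncard]; omega) hx
  have hsrc : x ∈ (inputChart a).source := fun i => (hpos _).2 (Or.inr ⟨i, rfl⟩)
  refine ⟨inputChart a x, (inputChart a).map_source hsrc, ?_, (inputChart a).left_inv hsrc⟩
  have hu : inputChart a x ∈ bipyr n := (inputChart a).map_source hsrc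
  have h1 : (0 : ℝ) < (x : A ⊕ A → ℝ) (inputStar a).q := (hpos _).2 (Or.inl rfl)
  have h2 : ((inputChart a).symm (inputChart a x) : A ⊕ A → ℝ) = x :=
    congrArg _ ((inputChart a).left_inv hsrc)
  rw [← h2] at h1
  have h3 := (inputStar a).coe_chart_symm hu
  rw [show (inputChart a).symm (inputChart a x) = (inputStar a).chart.symm (inputChart a x) from rfl,
    h3, Star.map_q] at h1
  rcases lt_max_iff.1 h1 with h | h
  · linarith
  · exact absurd h (lt_irrefl _)

/-- At points of an open facet, the ambient coordinates of the tangent vector with components `v`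
in the chart of input type. -/
theorem mfderiv_coord_mfderiv_symm (a : Q.NCT) {u : EuclideanSpace ℝ (Fin n)} (hu : u ∈ bipyr n)
    (hs : ∑ i, u i < 1) (s : A ⊕ A) (v : EuclideanSpace ℝ (Fin n)) :
    mfderiv 𝓘(ℝ, EuclideanSpace ℝ (Fin n)) 𝓘(ℝ, ℝ) (fun y : Q.OSer => (y : A ⊕ A → ℝ) s)
      ((inputChart a).symm u)
      (mfderiv 𝓘(ℝ, EuclideanSpace ℝ (Fin n)) 𝓘(ℝ, EuclideanSpace ℝ (Fin n))
        (inputChart a).symm u v) =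
      ∑ i, v i * (vertexPt (Sum.inl (a.1 i)) s - vertexPt (Sum.inr (Q.op a.1)) s) := by
  have : IsManifold 𝓘(ℝ, EuclideanSpace ℝ (Fin n)) ∞ Q.OSer := isManifold_OSer
  have hD := (inputStar a).hasFDerivAt_bipyrMap hs s
  set f : Q.OSer → ℝ := fun y => (y : A ⊕ A → ℝ) s
  have hut : u ∈ (inputChart a).target := hu
  have hsrc : (inputChart a).symm u ∈ (inputChart a).source := (inputChart a).map_target hut
  have hinv : inputChart a ((inputChart a).symm u) = u := (inputChart a).right_inv hut
  -- Ambient coordinates can have kinks along creases, where `mfderiv` would be the default 0; off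
  -- the crease, `f` is locally the chart followed by an affine map.
  have hf : MDifferentiableAt 𝓘(ℝ, EuclideanSpace ℝ (Fin n)) 𝓘(ℝ, ℝ) f
      ((inputChart a).symm u) := by
    have he : MDifferentiableAt 𝓘(ℝ, EuclideanSpace ℝ (Fin n)) 𝓘(ℝ, EuclideanSpace ℝ (Fin n))
        (inputChart a) ((inputChart a).symm u) :=
      mdifferentiableAt_atlas (inputChart_mem_atlas a) hsrc
    have hD' : MDifferentiableAt 𝓘(ℝ, EuclideanSpace ℝ (Fin n)) 𝓘(ℝ, ℝ)
        (fun w => bipyrMap (inputStar a).p (inputStar a).q (inputStar a).q' w s)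
        (inputChart a ((inputChart a).symm u)) := by
      rw [hinv]
      exact hD.differentiableAt.mdifferentiableAt
    refine (hD'.comp _ he).congr_of_eventuallyEq ?_
    filter_upwards [(inputChart a).open_source.mem_nhds hsrc] with y hy
    exact (congrFun ((inputStar a).map_coords y.2 hy) s).symm
  obtain ⟨L, -, hL⟩ := exists_hasMFDerivAt_symm (inputChart_mem_atlas a) hut
  have hcomp : HasMFDerivAt 𝓘(ℝ, EuclideanSpace ℝ (Fin n)) 𝓘(ℝ, ℝ)
      (f ∘ (inputChart a).symm) u _ := hf.hasMFDerivAt.comp u hL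
  have hcomp' : HasMFDerivAt 𝓘(ℝ, EuclideanSpace ℝ (Fin n)) 𝓘(ℝ, ℝ)
      (f ∘ (inputChart a).symm) u
      (∑ i, (vertexPt ((inputStar a).p i) s - vertexPt (inputStar a).q s) •
        EuclideanSpace.proj (𝕜 := ℝ) i : EuclideanSpace ℝ (Fin n) →L[ℝ] ℝ) := by
    refine hD.hasMFDerivAt.congr_of_eventuallyEq ?_
    filter_upwards [(inputChart a).open_target.mem_nhds hut] with w hw
    exact congrFun ((inputStar a).coe_chart_symm hw) s
  -- The chain rule and the explicit affine formula give the same derivative of `f ∘ (inputChart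
  -- a).symm`.
  have h := DFunLike.congr_fun (hasMFDerivAt_unique hcomp hcomp') v
  rw [hL.mfderiv]
  refine Eq.trans h ?_
  refine Eq.trans (sum_apply (F := EuclideanSpace ℝ (Fin n) →L[ℝ] ℝ) _ _ _) ?_
  exact Finset.sum_congr rfl fun i _ =>
    mul_comm (vertexPt ((inputStar a).p i) s - vertexPt (inputStar a).q s) (v i)

theorem isAmbient_coordVec (a : Q.NCT) {u : EuclideanSpace ℝ (Fin n)} (hu : u ∈ bipyr n)
    (hs : ∑ i, u i < 1) (i : Fin n) :
    IsAmbient ((inputChart a).symm u) (coordVec (inputChart a) u i)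
      (vertexPt (Sum.inl (a.1 i)) - vertexPt (Sum.inr (Q.op a.1))) := by
  intro s
  refine (mfderiv_coord_mfderiv_symm a hu hs s _).trans ?_
  simp [PiLp.single_apply]
  rfl

/-- The ambient coordinate at the input vertex of `a j` is the j-th chart component, since the
entries of `a` are distinct and the apex is an output vertex. So ambient vectors determine tangent
vectors, and the facet rule concerns coordinate vectors only. -/
theorem eq_coordVec_of_isAmbient (a : Q.NCT) {u : EuclideanSpace ℝ (Fin n)} (hu : u ∈ bipyr n)
    (hs : ∑ i, u i < 1) {i : Fin n}
    {v : TangentSpace 𝓘(ℝ, EuclideanSpace ℝ (Fin n)) ((inputChart a).symm u)}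
    (hv : IsAmbient ((inputChart a).symm u) v
      (vertexPt (Sum.inl (a.1 i)) - vertexPt (Sum.inr (Q.op a.1)))) :
    v = coordVec (inputChart a) u i := by
  obtain ⟨L, hL, hd⟩ := exists_hasMFDerivAt_symm (inputChart_mem_atlas a) hu
  obtain ⟨v', hv'⟩ := (bijective_of_simplexForm_eq hL).2 v
  rw [coordVec, hd.mfderiv]
  refine hv'.symm.trans (congrArg L ?_)
  ext j
  have h := hv (Sum.inl (a.1 j))
  have h' := mfderiv_coord_mfderiv_symm a hu hs (Sum.inl (a.1 j)) v'
  rw [hd.mfderiv] at h'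
  have h'' := h'.symm.trans ((congrArg _ hv').trans h)
  have hinj : ∀ k l, a.1 k = a.1 l ↔ k = l := fun _ _ => (injective_of_mem a.2).eq_iff
  simpa [vertexPt, Pi.single_apply, hinj] using! h''

theorem isStandardMetric_stdInner : IsStandardMetric (stdInner Q) where
  facet a x hx i j v w hv hw := by
    obtain ⟨u, hu, hs, rfl⟩ := exists_inputChart_symm a hx
    rw [eq_coordVec_of_isAmbient a hu hs hv, eq_coordVec_of_isAmbient a hu hs hw]
    exact stdInner_coordVec (inputChart_mem_atlas a) hu i j
  output a _ hu _ i j := stdInner_coordVec (outputChart_mem_atlas a) hu i j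
  input a _ hu _ i j := stdInner_coordVec (inputChart_mem_atlas a) hu i j

theorem range_outputStar (a : Q.NCT) : Set.range (outputStar a).p = outputFace a := by
  ext s
  constructor
  · rintro ⟨i, rfl⟩
    by_cases hi : i = lastIdx (two_le_of_mem a.2)
    · exact Or.inl (if_pos hi)
    · exact Or.inr ⟨i, hi, (if_neg hi).symm⟩
  · rintro (rfl | ⟨i, hi, rfl⟩)
    · exact ⟨lastIdx (two_le_of_mem a.2), if_pos rfl⟩
    · exact ⟨i, if_neg hi⟩

/-- Positivity puts the crease inside `γ`, and both have n elements. -/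
theorem _root_.Serenation.Star.range_eq_of_mem_ocvx {V : Type*} {Γ : Set (Set V)} (S : Star n Γ)
    {γ : Set V} (hγ : γ.ncard = n) {x : V → ℝ} (hx : x ∈ ocvx (vertexPt '' γ))
    (hp : ∀ i, 0 < x (S.p i)) : Set.range S.p = γ := by
  have hn := S.pos
  have hne : γ.ncard ≠ 0 := by omega
  refine Set.eq_of_subset_of_ncard_le ?_ ?_ (Set.finite_of_ncard_ne_zero hne)
  · rintro _ ⟨i, rfl⟩
    exact (pos_iff_of_mem_ocvx hne hx _).1 (hp i)
  · rw [hγ, ← Set.image_univ, Set.ncard_image_of_injective _ S.inj]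
    simp

theorem IsStandardMetric.eq_stdInner {h : BilinField n Q.OSer} (hh : IsStandardMetric h) :
    h = stdInner Q := by
  funext x
  obtain ⟨γ, ⟨⟨a, ha, hγa⟩, hcard⟩, hxγ⟩ := Set.mem_iUnion₂.1 x.2
  rcases hcard with hcard | hcard
  -- On a face with n vertices any serene chart around `x` works: its crease is that face, so the
  -- input or output rule applies.
  · obtain ⟨e, he, hxe⟩ := exists_chart x
    obtain ⟨b, rfl | rfl⟩ := Set.mem_iUnion.1 he
    · have hγ : inputFace b = γ := (inputStar b).range_eq_of_mem_ocvx hcard hxγ hxe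
      obtain ⟨u, hu, rfl⟩ : ∃ u ∈ bipyr n, (inputChart b).symm u = x :=
        ⟨_, (inputChart b).map_source hxe, (inputChart b).left_inv hxe⟩
      exact eq_stdInner_apply he hu (hh.input b u hu (hγ ▸ hxγ))
    · have hγ : outputFace b = γ := (range_outputStar b).symm.trans
        ((outputStar b).range_eq_of_mem_ocvx hcard hxγ hxe)
      obtain ⟨u, hu, rfl⟩ : ∃ u ∈ bipyr n, (outputChart b).symm u = x :=
        ⟨_, (outputChart b).map_source hxe, (outputChart b).left_inv hxe⟩
      exact eq_stdInner_apply he hu (hh.output b u hu (hγ ▸ hxγ))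
  -- With n+1 vertices the face exhausts the facet containing it.
  · have hγ : γ = Q.facet a := Set.eq_of_subset_of_ncard_le hγa
      (by rw [hcard, facet_ncard ⟨a, ha⟩])
      (Set.finite_of_ncard_ne_zero (by rw [facet_ncard ⟨a, ha⟩]; omega))
    subst hγ
    obtain ⟨u, hu, hs, rfl⟩ := exists_inputChart_symm ⟨a, ha⟩ hxγ
    exact eq_stdInner_apply (inputChart_mem_atlas _) hu fun i j => hh.facet ⟨a, ha⟩ _ hxγ i j _ _
      (isAmbient_coordVec _ hu hs i) (isAmbient_coordVec _ hu hs j)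

end AltQuasigroup

end Serenation

theorem mainTheorem5 {n : ℕ} (hn : 1 ≤ n) {A : Type*} (Q : Serenation.AltQuasigroup n A) :
    T2Space Q.OSer ∧
    (∀ x : Q.OSer, SecondCountableTopology (connectedComponent x)) ∧
    ∃ _ : IsManifold 𝓘(ℝ, EuclideanSpace ℝ (Fin n)) ∞ Q.OSer,
    ∃ g : Bundle.ContMDiffRiemannianMetric 𝓘(ℝ, EuclideanSpace ℝ (Fin n)) ∞
        (EuclideanSpace ℝ (Fin n))
        (fun x : Q.OSer => TangentSpace 𝓘(ℝ, EuclideanSpace ℝ (Fin n)) x),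
      (∀ h : Serenation.BilinField n Q.OSer,
        Serenation.AltQuasigroup.IsStandardMetric h ↔ h = g.inner) ∧
      (∀ a : Q.NCT, ∀ u ∈ Serenation.bipyr n,
        Serenation.metricMatrix g.inner (Serenation.AltQuasigroup.inputChart a) u =
          Matrix.of (fun _ _ => (1 : ℝ)) + 1 ∧
        Serenation.metricMatrix g.inner (Serenation.AltQuasigroup.outputChart a) u =
          Matrix.of (fun _ _ => (1 : ℝ)) + 1) ∧
      Serenation.IsFlat g.inner := by
  -- The Hausdorff property is inherited from the product `ℝ^V`.
  refine ⟨inferInstance, Serenation.Star.secondCountableTopology_connectedComponent hn fun x => ?_,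
    Serenation.AltQuasigroup.isManifold_OSer, ?_⟩
  · obtain ⟨e, he, hx⟩ := Serenation.AltQuasigroup.exists_chart x
    obtain ⟨S, rfl⟩ := Serenation.AltQuasigroup.exists_star_of_mem_atlas he
    exact ⟨S, hx⟩
  · have : IsManifold 𝓘(ℝ, EuclideanSpace ℝ (Fin n)) ∞ Q.OSer := Serenation.AltQuasigroup.isManifold_OSer
    exact ⟨Serenation.AltQuasigroup.stdMetric Q,
      fun h => ⟨fun hh => hh.eq_stdInner, fun hh => hh ▸ Serenation.AltQuasigroup.isStandardMetric_stdInner⟩,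
      fun a u hu => ⟨Serenation.AltQuasigroup.metricMatrix_stdInner (Serenation.AltQuasigroup.inputChart_mem_atlas a) hu,
        Serenation.AltQuasigroup.metricMatrix_stdInner (Serenation.AltQuasigroup.outputChart_mem_atlas a) hu⟩, Serenation.AltQuasigroup.isFlat_stdInner⟩
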